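/- Let $k$ be a perfect field of characteristic $p>0$, let $G$ be a finite group, let $\rho\colon G\to \mathrm{Aut}_k\,k[[t]]$ be an injective homomorphism (a local $G$-action), and let $N$ be a normal subgroup of $G$. We write $f^g=\rho(g)(f)$ for $f\in k[[t]]$, $g \in G$. *Deformation functors.* Let $\varrho\colon H\to\mathrm{Aut}_k\,k[[t]]$ be a local action of a finite group $H$, and let $A$ be a local artinian ring with residue field $k$. A lift of $\varrho$ to $A$ is a homomorphism $\varrho_A\colon H\to \mathrm{Aut}_A\,A[[t]]$ reducing to $\varrho$; two lifts are equivalent if they are conjugate by an element of $\ker(\mathrm{Aut}_A\,A[[t]]\to\mathrm{Aut}_k\,k[[t]])$; and $D_H(A)$ is the set of equivalence classes. The tangent space $D_H(k[\varepsilon])$, $\varepsilon^2=0$, is identified with $H^1(H,\mathrm{Der})$, where $\mathrm{Der}=\mathrm{Der}_k\,k[[t]]$ carries the action $d^h=\varrho(h)\,d\,\varrho(h)^{-1}$: the class of a cocycle $(d_h)$ corresponds to the class of the lift $\varrho_A(h)=(1+\varepsilon d_h)\varrho(h)$, $A=k[\varepsilon]$. Put $y_N=\prod_{s\in N}t^s$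 and $y_G=\prod_{g\in G}t^g$. Then $k[[t]]^N=k[[y_N]]$ and $k[[t]]^G=k[[y_G]]$, and $G/N$ acts faithfully on $k[[y_N]]$; call this local action $\rho^\sharp$ and put $\mathrm{Der}^\sharp=\mathrm{Der}_k(k[[t]]^N)$. Write $D_G,D_N,D_{G/N}$ for the deformation functors of $\rho,\rho|_N,\rho^\sharp$. The group $G/N$ acts on $D_N$: $g_*$ sends the class of $\rho_A$ to the class of $n\mapsto r_g\,\rho_A(g^{-1}ng)\,r_g^{-1}$, for any $r_g\in\mathrm{Aut}_A\,A[[t]]$ lifting $\rho(g)$. Let $$\Phi=(\mathrm{res},\mathrm{ind})\colon D_G\to D_N^{G/N}\times D_{G/N},$$ where $\mathrm{res}$ restricts a lift to $N$, and $\mathrm{ind}$ sends the class of $\rho_A$ to the class of the induced action of $G/N$ on $A[[t]]^N\simeq A[[y]]$, $\prod_{s\in N}\rho_A(s)(t)\leftrightarrow y$. *The modules.* Regard $\mathrm{Der}$ and $\mathrm{Der}^\sharp$ as $G$-submodules of $k[[t]]$ through the embeddings $d\mapsto d(y_G)$. Let $\mathrm{Der}_1=\mathfrak D\cdot k[[t]]$,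 where $\mathfrak D$ is the different of $k[[t]]^N$ over $k[[t]]^G$. Then $\mathrm{Der}_1^N=\mathrm{Der}_1\cap k[[t]]^N=\mathrm{Der}^\sharp$, and the inclusion $\mathrm{Der}^N\subseteq\mathrm{Der}^\sharp$ is the restriction of derivations to $k[[t]]^N$. Let $\sigma\colon H^1(G/N,\mathrm{Der}^\sharp)\to H^1(G/N,\mathrm{Der}^\sharp/\mathrm{Der}^N)$ be the map induced by the projection. Then $\Phi$ induces on tangent spaces a $k$-linear map $$\Phi_{k[\varepsilon]}\colon H^1(G,\mathrm{Der})\to H^1(N,\mathrm{Der})^{G/N}\times H^1(G/N,\mathrm{Der}^\sharp),$$ and there is a well-defined $k$-linear map $\gamma\colon H^1(N,\mathrm{Der})^{G/N}\to H^1(G/N,\mathrm{Der}^\sharp/\mathrm{Der}^N)$ given as follows: for $\kappa=[d_s]\in H^1(N,\mathrm{Der})^{G/N}$, there are $\alpha\in\mathrm{Der}_1$ with $d_s=\alpha^s-\alpha$ for $s\in N$, and elements $a_g\in\mathrm{Der}_1^N=\mathrm{Der}^\sharp$, $b_g\in\mathrm{Der}$ with $\alpha^g-\alpha=a_g+b_g$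 for $g\in G$; the class $\bar a_g$ of $a_g$ modulo $\mathrm{Der}^N$ depends only on the class of $g$ in $G/N$ and is a $1$-cocycle of $G/N$, and $\gamma(\kappa)=-[\bar a_g]$. Moreover: (i) The kernel of $\Phi_{k[\varepsilon]}$ is isomorphic to $$\mathrm{coker}\bigl(\mathrm{Der}_1^G\to(\mathrm{Der}_1^N/\mathrm{Der}^N)^{G/N}\bigr);$$ the isomorphism sends the class of $b\in \mathrm{Der}_1^N$ (with $b^g-b\in\mathrm{Der}^N$ for all $g \in G$) to the class in $H^1(G,\mathrm{Der})$ of the cocycle $g\mapsto b^g-b$. (ii) The image of $\Phi_{k[\varepsilon]}$ is the fibred product $$H^1(N,\mathrm{Der})^{G/N}\times_{H^1(G/N,\mathrm{Der}^\sharp/\mathrm{Der}^N)}H^1(G/N,\mathrm{Der}^\sharp)=\{(\kappa,\lambda):\gamma(\kappa)=\sigma(\lambda)\}.$$ -/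

import Mathlib

open PowerSeries

universe u

set_option linter.unusedSectionVars false

noncomputable section

namespace LocalDeformation

/-- `Γ_A = Aut_A A⟦t⟧`. -/
abbrev Gam (A : Type u) [CommRing A] : Type u := A⟦X⟧ ≃ₐ[A] A⟦X⟧

/-- A local `G`-action: an injective homomorphism `G → Aut_k k⟦t⟧`. -/
structure LocalAction (k : Type u) [Field k] (G : Type u) [Group G] where
  toHom : G →* Gam k
  injective : Function.Injective toHom

/-- A lift of the local action `ρ` to `A` along the residue map `π : A → k`. -/
@[ext]
structure Lift {k : Type u} [Field k] {G : Type u} [Group G] (ρ : LocalAction k G)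
    {A : Type u} [CommRing A] (π : A →+* k) where
  toHom : G →* Gam A
  reduces : ∀ g f, PowerSeries.map π (toHom g f) = ρ.toHom g (PowerSeries.map π f)

/-- The action `ρ` itself, as a lift of `ρ` to `k`. -/
def LocalAction.self {k : Type u} [Field k] {G : Type u} [Group G] (ρ : LocalAction k G) :
    Lift ρ (RingHom.id k) where
  toHom := ρ.toHom
  reduces g f := by simp

section PowerSeriesFacts

theorem isAdicComplete_of_isNilpotent {A : Type u} [CommRing A] {I : Ideal A}
    (h : IsNilpotent I) : IsAdicComplete I A := by
  obtain ⟨n, hn⟩ := h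
  refine { haus' := fun x hx => ?_, prec' := fun f hf => ⟨f n, fun m => ?_⟩ }
  · have := hx n
    rw [hn] at this
    simpa [SModEq.zero] using this
  · rcases le_total m n with h | h
    · exact hf h
    · have := hf h
      rw [hn] at this
      have h2 : f n = f m := by simpa [SModEq.sub_mem, sub_eq_zero] using this
      rw [h2]

theorem maximalIdeal_nilpotent (A : Type u) [CommRing A] [IsLocalRing A] [IsArtinianRing A] :
    IsNilpotent (IsLocalRing.maximalIdeal A) := by
  have := IsArtinianRing.isNilpotent_jacobson_bot (R := A)
  rwa [IsLocalRing.jacobson_eq_maximalIdeal ⊥ bot_ne_top] at this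

variable {A : Type u} [CommRing A]

theorem X_pow_dvd_pow {a : A⟦X⟧} (ha : IsNilpotent (constantCoeff a)) (n : ℕ) :
    ∃ m, (X : A⟦X⟧) ^ n ∣ a ^ m := by
  let I := Ideal.span {(X : A⟦X⟧) ^ n}
  have hX : IsNilpotent (Ideal.Quotient.mk I X) :=
    ⟨n, by rw [← map_pow, Ideal.Quotient.eq_zero_iff_mem]; exact Ideal.mem_span_singleton_self _⟩
  have h : IsNilpotent (Ideal.Quotient.mk I a) := by
    rw [eq_X_mul_shift_add_const a, map_add, map_mul]
    refine Commute.isNilpotent_add (Commute.all _ _) ?_ ?_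
    · exact (Commute.all _ _).isNilpotent_mul_right hX
    · exact (ha.map (C (R := A))).map (Ideal.Quotient.mk I)
  obtain ⟨m, hm⟩ := h
  refine ⟨m, ?_⟩
  rwa [← map_pow, Ideal.Quotient.eq_zero_iff_mem, Ideal.mem_span_singleton] at hm

theorem eq_zero_of_forall_pow_dvd {a h : A⟦X⟧} (ha : IsNilpotent (constantCoeff a))
    (H : ∀ m, a ^ m ∣ h) : h = 0 := by
  ext n
  obtain ⟨m, hm⟩ := X_pow_dvd_pow ha (n + 1)
  exact (X_pow_dvd_iff.1 (hm.trans (H m))) n (Nat.lt_succ_self n)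

theorem algHom_ext_X {Φ Ψ : A⟦X⟧ →ₐ[A] A⟦X⟧} (h : Φ X = Ψ X)
    (ha : IsNilpotent (constantCoeff (Φ X))) : Φ = Ψ := by
  have hpoly : ∀ p : Polynomial A, Φ (p : A⟦X⟧) = Ψ (p : A⟦X⟧) := by
    intro p
    have : Φ.comp (Polynomial.coeToPowerSeries.algHom A) =
        Ψ.comp (Polynomial.coeToPowerSeries.algHom A) := by
      apply Polynomial.algHom_ext
      simpa using h
    simpa using DFunLike.congr_fun this p
  ext1 f
  rw [← sub_eq_zero]
  refine eq_zero_of_forall_pow_dvd ha fun m => ?_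
  rw [eq_X_pow_mul_shift_add_trunc m f, map_add, map_add, map_mul, map_mul, hpoly, map_pow,
    map_pow, ← h, add_sub_add_right_eq_sub, ← mul_sub]
  exact dvd_mul_right _ _

/-- Substitution `X ↦ y`, for `y` with nilpotent constant coefficient. -/
def substHom (y : A⟦X⟧) (hs : IsNilpotent (constantCoeff y)) : A⟦X⟧ →ₐ[A] A⟦X⟧ :=
  substAlgHom (R := A) (a := y) (show HasSubst y from hs)

theorem substHom_apply (y : A⟦X⟧) (hs : IsNilpotent (constantCoeff y)) (f : A⟦X⟧) :
    substHom y hs f = f.subst y := by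
  rw [substHom, coe_substAlgHom]

theorem substHom_X (y : A⟦X⟧) (hs : IsNilpotent (constantCoeff y)) : substHom y hs X = y := by
  rw [substHom_apply, subst_X (show HasSubst y from hs)]

theorem substHom_C (y : A⟦X⟧) (hs : IsNilpotent (constantCoeff y)) (a : A) :
    substHom y hs (C a) = C a := by
  simpa using (substHom y hs).commutes a

variable [IsLocalRing A] [IsArtinianRing A]

theorem isNilpotent_of_not_isUnit {a : A} (h : ¬ IsUnit a) : IsNilpotent a := by
  obtain ⟨n, hn⟩ := maximalIdeal_nilpotent A
  refine ⟨n, ?_⟩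
  have : a ^ n ∈ IsLocalRing.maximalIdeal A ^ n := Ideal.pow_mem_pow (by simpa using h) n
  rw [hn] at this
  simpa using this

theorem isNilpotent_constantCoeff_map_X (φ : Gam A) : IsNilpotent (constantCoeff (φ X)) := by
  apply isNilpotent_of_not_isUnit
  rw [← isUnit_iff_constantCoeff, isUnit_map_iff, isUnit_iff_constantCoeff]
  simp

theorem gam_ext {φ ψ : Gam A} (h : φ X = ψ X) : φ = ψ := by
  have : (φ : A⟦X⟧ →ₐ[A] A⟦X⟧) = ψ := algHom_ext_X h (isNilpotent_constantCoeff_map_X φ)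
  ext1 f
  exact DFunLike.congr_fun this f




theorem order_map_mk {k : Type u} [Field k] {π : A →+* k} (hπ : Function.Surjective π)
    {y : A⟦X⟧} {n : ℕ} (hy : (PowerSeries.map π y).order = n) :
    (PowerSeries.map (Ideal.Quotient.mk (IsLocalRing.maximalIdeal A)) y).order = n := by
  have hker := IsLocalRing.ker_eq_maximalIdeal π hπ
  have key : ∀ a : A, Ideal.Quotient.mk (IsLocalRing.maximalIdeal A) a = 0 ↔ π a = 0 := by
    intro a
    rw [Ideal.Quotient.eq_zero_iff_mem, ← hker, RingHom.mem_ker]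
  rw [order_eq_nat] at hy ⊢
  simp only [coeff_map] at hy ⊢
  exact ⟨fun h => hy.1 ((key _).1 h), fun i hi => (key _).2 (hy.2 i hi)⟩

theorem isWeierstrassDivisor {k : Type u} [Field k] {π : A →+* k} (hπ : Function.Surjective π)
    {y : A⟦X⟧} {n : ℕ} (hy : (PowerSeries.map π y).order = n) : y.IsWeierstrassDivisor := by
  apply IsWeierstrassDivisor.of_map_ne_zero
  intro h
  have h1 := order_map_mk hπ hy
  have h2 : PowerSeries.map (Ideal.Quotient.mk (IsLocalRing.maximalIdeal A)) y = 0 := h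
  rw [h2, order_zero] at h1
  exact ENat.top_ne_natCast n h1

theorem exists_division {k : Type u} [Field k] {π : A →+* k} (hπ : Function.Surjective π)
    {y : A⟦X⟧} {n : ℕ} (hy : (PowerSeries.map π y).order = n) (f : A⟦X⟧) :
    ∃ (q : A⟦X⟧) (r : Polynomial A), r.degree < n ∧ f = y * q + r := by
  have := isAdicComplete_of_isNilpotent (maximalIdeal_nilpotent A)
  have h := (isWeierstrassDivisor hπ hy).isWeierstrassDivisionAt_div_mod f
  refine ⟨_, _, ?_, h.eq_mul_add⟩
  have h2 := h.degree_lt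
  rwa [order_map_mk hπ hy, ENat.toNat_natCast] at h2

theorem division_unique {k : Type u} [Field k] {π : A →+* k} (hπ : Function.Surjective π)
    {y : A⟦X⟧} {n : ℕ} (hy : (PowerSeries.map π y).order = n) {q : A⟦X⟧} {r : Polynomial A}
    (hr : r.degree < n) (h : y * q = r) : q = 0 ∧ r = 0 := by
  have := isAdicComplete_of_isNilpotent (maximalIdeal_nilpotent A)
  refine (isWeierstrassDivisor hπ hy).eq_zero_of_mul_eq ?_ h
  rwa [order_map_mk hπ hy, ENat.toNat_natCast]

theorem mem_nonZeroDivisors_of_map_ne_zero {k : Type u} [Field k] {π : A →+* k}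
    (hπ : Function.Surjective π) {y : A⟦X⟧} (hy : PowerSeries.map π y ≠ 0) :
    y ∈ nonZeroDivisors A⟦X⟧ := by
  have hn : (PowerSeries.map π y).order = ((PowerSeries.map π y).order.toNat : ℕ∞) :=
    (ENat.natCast_toNat (by simpa [order_eq_top] using hy)).symm
  rw [mem_nonZeroDivisors_iff_right]
  intro z hz
  refine (division_unique hπ hn (q := z) (r := 0) ?_ ?_).1
  · rw [Polynomial.degree_zero]; exact WithBot.bot_lt_coe _
  · rw [mul_comm, hz]; simp

/-- Every power series is a combination of `1, X, …, X ^ (n - 1)` with coefficients in `A⟦y⟧`. -/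
theorem exists_expansion {k : Type u} [Field k] {π : A →+* k} (hπ : Function.Surjective π)
    {y : A⟦X⟧} {n : ℕ} (hy : (PowerSeries.map π y).order = n)
    (hs : IsNilpotent (constantCoeff y)) (f : A⟦X⟧) :
    ∃ c : ℕ → A⟦X⟧, f = ∑ i ∈ Finset.range n, X ^ i * substHom y hs (c i) := by
  choose q r hr hq using exists_division hπ hy
  let F : ℕ → A⟦X⟧ := fun j => q^[j] f
  have hF : ∀ j, F j = y * F (j + 1) + (r (F j) : A⟦X⟧) := by
    intro j
    have : F (j + 1) = q (F j) := Function.iterate_succ_apply' q j f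
    rw [this]
    exact hq (F j)
  let ι := substHom y hs
  have hιX : ι X = y := substHom_X y hs
  have hexp : ∀ p : Polynomial A, p.degree < n →
      (p : A⟦X⟧) = ∑ i ∈ Finset.range n, X ^ i * ι (C (p.coeff i)) := by
    intro p hp
    ext j
    have h1 : ∀ i, coeff j (X ^ i * ι (C (p.coeff i))) = if i = j then p.coeff j else 0 := by
      intro i
      rw [show ι (C (p.coeff i)) = C (p.coeff i) from substHom_C y hs _, coeff_mul_C, coeff_X_pow]
      by_cases hij : i = j
      · subst hij; simp
      · rw [if_neg hij, if_neg (Ne.symm hij), zero_mul]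
    rw [map_sum, Finset.sum_congr rfl fun i _ => h1 i, Finset.sum_ite_eq', Polynomial.coeff_coe]
    split_ifs with h
    · rfl
    · exact Polynomial.coeff_eq_zero_of_degree_lt (lt_of_lt_of_le hp (by simpa using h))
  let c : ℕ → A⟦X⟧ := fun i => PowerSeries.mk fun j => (r (F j)).coeff i
  refine ⟨c, ?_⟩
  rw [← sub_eq_zero]
  refine eq_zero_of_forall_pow_dvd hs fun m => ?_
  let cc : ℕ → ℕ → A⟦X⟧ := fun m i => PowerSeries.mk fun j => (r (F (j + m))).coeff i
  have step : ∀ m, f - ∑ i ∈ Finset.range n, X ^ i * ι (c i) =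
      y ^ m * (F m - ∑ i ∈ Finset.range n, X ^ i * ι (cc m i)) := by
    intro m
    induction m with
    | zero => simp [F, cc, c]
    | succ m ih =>
      rw [ih]
      have h1 : ∀ i, cc m i = C ((r (F m)).coeff i) + X * cc (m + 1) i := by
        intro i
        ext j
        rcases j with _ | j
        · simp [cc]
        · simp [cc, coeff_succ_X_mul, add_assoc, add_comm 1 m]
      have h2 : ∑ i ∈ Finset.range n, X ^ i * ι (cc m i) =
          (r (F m) : A⟦X⟧) + y * ∑ i ∈ Finset.range n, X ^ i * ι (cc (m + 1) i) := by
        rw [hexp (r (F m)) (hr _), Finset.mul_sum, ← Finset.sum_add_distrib]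
        refine Finset.sum_congr rfl fun i _ => ?_
        rw [h1, map_add, map_mul, hιX]
        ring
      rw [h2, pow_succ]
      have h3 := hF m
      linear_combination (y ^ m) * h3
  rw [step m]
  exact dvd_mul_right _ _

theorem subst_injective {k : Type u} [Field k] {π : A →+* k} (hπ : Function.Surjective π)
    {y : A⟦X⟧} {n : ℕ} (hn : 0 < n) (hy : (PowerSeries.map π y).order = n)
    (hs : IsNilpotent (constantCoeff y)) :
    Function.Injective (substHom y hs) := by
  rw [injective_iff_map_eq_zero]
  have aux : ∀ c : A⟦X⟧, substHom y hs c = 0 →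
      substHom y hs (PowerSeries.mk fun p => coeff (p + 1) c) = 0 ∧ constantCoeff c = 0 := by
    intro c hc
    rw [eq_X_mul_shift_add_const c, map_add, map_mul, substHom_X, substHom_C] at hc
    have hd : (-Polynomial.C (constantCoeff c)).degree < n := by
      rw [Polynomial.degree_neg]
      exact lt_of_le_of_lt Polynomial.degree_C_le (by exact_mod_cast hn)
    have h := division_unique hπ hy hd
      (q := substHom y hs (PowerSeries.mk fun p => coeff (p + 1) c))
      (by rw [eq_neg_of_add_eq_zero_left hc]; simp)
    exact ⟨h.1, by simpa using h.2⟩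
  have key : ∀ (m : ℕ) (c : A⟦X⟧), substHom y hs c = 0 → coeff m c = 0 := by
    intro m
    induction m with
    | zero =>
      intro c hc
      simpa using (aux c hc).2
    | succ m ih =>
      intro c hc
      simpa using ih _ (aux c hc).1
  intro c hc
  ext m
  simpa using key m c hc

theorem order_gam_X {k : Type u} [Field k] (φ : Gam k) : (φ X).order = (1 : ℕ) := by
  rw [order_eq_nat]
  have h0 : constantCoeff (φ X) = 0 := (isNilpotent_constantCoeff_map_X φ).eq_zero
  refine ⟨fun h1 => ?_, fun i hi => ?_⟩
  · obtain ⟨f, hf⟩ := φ.surjective X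
    rw [eq_X_mul_shift_add_const f, map_add, map_mul] at hf
    have hC : φ (C (constantCoeff f)) = C (constantCoeff f) := by
      simpa using φ.commutes (constantCoeff f)
    rw [hC] at hf
    have := congrArg (coeff 1) hf
    rw [map_add, coeff_mul, Finset.Nat.antidiagonal_succ] at this
    simp [h0, h1] at this
  · obtain rfl : i = 0 := by omega
    simpa using h0

variable {k : Type u} [Field k] {H : Type u} [Group H] [Finite H] {ρ : LocalAction k H}

/-- The norm `∏_{h} τ(h)(t)`. -/
def normX (τ : H →* Gam A) : A⟦X⟧ := ∏ᶠ h : H, τ h X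

theorem map_normX {τ : H →* Gam A} {g : H} : τ g (normX τ) = normX τ := by
  classical
  have := Fintype.ofFinite H
  rw [normX, finprod_eq_prod_of_fintype, map_prod]
  refine Fintype.prod_equiv (Equiv.mulLeft g) _ _ fun h => ?_
  simp

theorem isNilpotent_normX (τ : H →* Gam A) : IsNilpotent (constantCoeff (normX τ)) := by
  classical
  have := Fintype.ofFinite H
  rw [normX, finprod_eq_prod_of_fintype, ← Finset.mul_prod_erase _ _ (Finset.mem_univ (1 : H)),
    map_mul]
  exact (Commute.all _ _).isNilpotent_mul_right (isNilpotent_constantCoeff_map_X _)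

theorem Lift.map_normX {π : A →+* k} (L : Lift ρ π) :
    PowerSeries.map π (normX L.toHom) = normX ρ.toHom := by
  classical
  have := Fintype.ofFinite H
  rw [normX, normX, finprod_eq_prod_of_fintype, finprod_eq_prod_of_fintype, map_prod]
  refine Finset.prod_congr rfl fun h _ => ?_
  rw [L.reduces, map_X]

theorem LocalAction.order_normX (ρ : LocalAction k H) :
    (normX ρ.toHom).order = (Nat.card H : ℕ) := by
  classical
  have := Fintype.ofFinite H
  rw [normX, finprod_eq_prod_of_fintype, order_prod, Finset.sum_congr rfl fun h _ =>
    order_gam_X (ρ.toHom h)]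
  simp

/-- The ring `A⟦t⟧ ^ H` of invariants. -/
def invariantRing (τ : H →* Gam A) : Subalgebra A A⟦X⟧ where
  carrier := {f | ∀ h, τ h f = f}
  mul_mem' hf hg h := by rw [map_mul, hf h, hg h]
  add_mem' hf hg h := by rw [map_add, hf h, hg h]
  algebraMap_mem' a h := (τ h).commutes a

theorem mem_invariantRing {τ : H →* Gam A} {f : A⟦X⟧} :
    f ∈ invariantRing τ ↔ ∀ h, τ h f = f := Iff.rfl

/-- The embedding `A⟦y⟧ → A⟦t⟧`, `y ↦ ∏_{h} τ(h)(t)`. -/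
def normEmb (τ : H →* Gam A) : A⟦X⟧ →ₐ[A] A⟦X⟧ := substHom (normX τ) (isNilpotent_normX τ)

theorem map_normEmb (τ : H →* Gam A) (h : H) (f : A⟦X⟧) : τ h (normEmb τ f) = normEmb τ f := by
  have : ((τ h : A⟦X⟧ →ₐ[A] A⟦X⟧)).comp (normEmb τ) = normEmb τ := by
    refine algHom_ext_X ?_ ?_
    · simp [normEmb, substHom_X, map_normX]
    · simpa [normEmb, substHom_X, map_normX] using isNilpotent_normX τ
  exact DFunLike.congr_fun this f

theorem Lift.normEmb_injective {π : A →+* k} (hπ : Function.Surjective π) (L : Lift ρ π) :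
    Function.Injective (normEmb L.toHom) := by
  refine subst_injective hπ (n := Nat.card H) Nat.card_pos ?_ _
  rw [L.map_normX, ρ.order_normX]

theorem Lift.normEmb_surjective {π : A →+* k} (hπ : Function.Surjective π) (L : Lift ρ π)
    {f : A⟦X⟧} (hf : f ∈ invariantRing L.toHom) : ∃ c, normEmb L.toHom c = f := by
  classical
  obtain ⟨c, hc⟩ := exists_expansion hπ (y := normX L.toHom) (n := Nat.card H)
    (by rw [L.map_normX, ρ.order_normX]) (isNilpotent_normX _) f
  let e : Fin (Nat.card H) ≃ H := (Finite.equivFin H).symm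
  let v : Fin (Nat.card H) → A⟦X⟧ := fun i => L.toHom (e i) X
  let M := Matrix.vandermonde v
  let i0 : Fin (Nat.card H) := ⟨0, Nat.card_pos⟩
  let w : Fin (Nat.card H) → A⟦X⟧ := fun i =>
    normEmb L.toHom (c i) - if i = i0 then f else 0
  have hMw : M.mulVec w = 0 := by
    ext1 i
    have h1 : f = ∑ j ∈ Finset.range (Nat.card H), (v i) ^ j * normEmb L.toHom (c j) := by
      have h2 := congrArg (L.toHom (e i)) hc
      rw [hf (e i), map_sum] at h2
      rw [h2]
      refine Finset.sum_congr rfl fun j _ => ?_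
      rw [map_mul, map_pow]
      congr 1
      exact map_normEmb L.toHom (e i) (c j)
    rw [Finset.sum_range] at h1
    simp only [Matrix.mulVec, dotProduct, M, Matrix.vandermonde_apply, w, mul_sub,
      Finset.sum_sub_distrib, Pi.zero_apply]
    rw [← h1, Finset.sum_eq_single i0]
    · simp [i0]
    · intro j _ hj
      simp [hj]
    · simp
  have hdet : M.det ∈ nonZeroDivisors A⟦X⟧ := by
    rw [Matrix.det_vandermonde]
    refine prod_mem fun i _ => prod_mem fun j hj => ?_
    refine mem_nonZeroDivisors_of_map_ne_zero hπ ?_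
    rw [map_sub, L.reduces, L.reduces, map_X, sub_ne_zero]
    intro h
    have h2 := ρ.injective (gam_ext h)
    have h3 := e.injective h2
    simp [h3] at hj
  have hw : w i0 = 0 := by
    have h1 : M.det • w = 0 := by
      have : (M.adjugate * M).mulVec w = 0 := by
        rw [← Matrix.mulVec_mulVec, hMw, Matrix.mulVec_zero]
      rwa [Matrix.adjugate_mul, Matrix.smul_mulVec, Matrix.one_mulVec] at this
    have h2 := congrFun h1 i0
    simp only [Pi.smul_apply, smul_eq_mul, Pi.zero_apply] at h2
    exact (mem_nonZeroDivisors_iff.1 hdet).1 _ h2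
  refine ⟨c i0, ?_⟩
  simpa [w, sub_eq_zero] using hw

/-- The isomorphism `A⟦y⟧ ≃ A⟦t⟧ ^ H`, `y ↦ ∏_{h} ρ_A(h)(t)`. -/
def Lift.invariantEquiv {π : A →+* k} (hπ : Function.Surjective π) (L : Lift ρ π) :
    A⟦X⟧ ≃ₐ[A] invariantRing L.toHom :=
  AlgEquiv.ofBijective ((normEmb L.toHom).codRestrict (invariantRing L.toHom)
    fun f h => map_normEmb L.toHom h f)
    ⟨fun _ _ h => L.normEmb_injective hπ (congrArg Subtype.val h),
      fun f => (L.normEmb_surjective hπ f.2).imp fun _ hc => Subtype.ext hc⟩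

theorem Lift.coe_invariantEquiv {π : A →+* k} (hπ : Function.Surjective π) (L : Lift ρ π)
    (f : A⟦X⟧) : (L.invariantEquiv hπ f : A⟦X⟧) = normEmb L.toHom f := rfl

theorem Lift.map_normEmb {π : A →+* k} (L : Lift ρ π) (f : A⟦X⟧) :
    PowerSeries.map π (normEmb L.toHom f) = normEmb ρ.toHom (PowerSeries.map π f) := by
  rw [normEmb, normEmb, substHom_apply, substHom_apply, ← L.map_normX]
  exact map_subst (show HasSubst (normX L.toHom) from isNilpotent_normX L.toHom) f

end PowerSeriesFacts

section Deformations

variable {k : Type u} [Field k] {G : Type u} [Group G] {ρ : LocalAction k G}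
  {A : Type u} [CommRing A] {π : A →+* k}

/-- Two lifts are equivalent if they are conjugate by an element of `ker (Γ_A → Γ_k)`. -/
def Lift.Equivalent (L L' : Lift ρ π) : Prop :=
  ∃ χ : Gam A, (∀ f, PowerSeries.map π (χ f) = PowerSeries.map π f) ∧
    ∀ g, L'.toHom g = χ * L.toHom g * χ⁻¹

theorem map_inv_of_reduces {χ : Gam A} {φ : Gam k}
    (h : ∀ f, PowerSeries.map π (χ f) = φ (PowerSeries.map π f)) (f : A⟦X⟧) :
    PowerSeries.map π (χ⁻¹ f) = φ⁻¹ (PowerSeries.map π f) := by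
  have h1 := h (χ⁻¹ f)
  rw [← AlgEquiv.mul_apply, mul_inv_cancel, AlgEquiv.one_apply] at h1
  rw [h1, ← AlgEquiv.mul_apply, inv_mul_cancel, AlgEquiv.one_apply]

theorem map_inv_of_reduces_one {χ : Gam A}
    (h : ∀ f, PowerSeries.map π (χ f) = PowerSeries.map π f) (f : A⟦X⟧) :
    PowerSeries.map π (χ⁻¹ f) = PowerSeries.map π f := by
  simpa using map_inv_of_reduces (φ := 1) (by simpa using h) f

/-- Equivalence of lifts is an equivalence relation. -/
instance Lift.setoid (ρ : LocalAction k G) (π : A →+* k) : Setoid (Lift ρ π) where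
  r := Lift.Equivalent
  iseqv :=
    { refl := fun L => ⟨1, by simp, by simp⟩
      symm := by
        rintro L L' ⟨χ, h, hL⟩
        exact ⟨χ⁻¹, map_inv_of_reduces_one h, fun g => by rw [hL]; group⟩
      trans := by
        rintro L L' L'' ⟨χ, h, hL⟩ ⟨χ', h', hL'⟩
        refine ⟨χ' * χ, fun f => by rw [AlgEquiv.mul_apply, h', h], fun g => ?_⟩
        rw [hL', hL]
        group }

/-- The value `D_ρ(A)` at `A` (with residue map `π : A → k`) of the infinitesimal deformation
functor of the local action `ρ`. -/
def Deform (ρ : LocalAction k G) {A : Type u} [CommRing A] (π : A →+* k) : Type u :=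
  Quotient (Lift.setoid ρ π)

/-! ### Restriction -/

/-- The restriction of a local `G`-action to a subgroup. -/
def LocalAction.restrict (ρ : LocalAction k G) (N : Subgroup G) : LocalAction k N where
  toHom := ρ.toHom.comp N.subtype
  injective := ρ.injective.comp N.subtype_injective

/-- The restriction of a lift to a subgroup. -/
def Lift.restrict (L : Lift ρ π) (N : Subgroup G) : Lift (ρ.restrict N) π where
  toHom := L.toHom.comp N.subtype
  reduces n f := L.reduces n f

/-- The restriction map `D_G(A) → D_N(A)`. -/
def Deform.res (N : Subgroup G) : Deform ρ π → Deform (ρ.restrict N) π :=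
  Quotient.map (fun L => L.restrict N) fun _ _ ⟨χ, h, hL⟩ => ⟨χ, h, fun n => hL n⟩

/-- The lift `n ↦ r ρ_A(g⁻¹ n g) r⁻¹`, where `r` is a lift of `ρ(g)` to `A`. -/
def Lift.conj {N : Subgroup G} [N.Normal] (L : Lift (ρ.restrict N) π) (g : G) (r : Gam A)
    (hr : ∀ f, PowerSeries.map π (r f) = ρ.toHom g (PowerSeries.map π f)) :
    Lift (ρ.restrict N) π where
  toHom := (MulAut.conj r).toMonoidHom.comp
    (L.toHom.comp (MulAut.conjNormal (g⁻¹) : MulAut N).toMonoidHom)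
  reduces n f := by
    change PowerSeries.map π ((r * L.toHom (MulAut.conjNormal (g⁻¹) n) * r⁻¹) f) =
      ρ.toHom (n : G) (PowerSeries.map π f)
    rw [AlgEquiv.mul_apply, AlgEquiv.mul_apply, hr, L.reduces, map_inv_of_reduces hr]
    have : (ρ.restrict N).toHom (MulAut.conjNormal (g⁻¹) n) = ρ.toHom (g⁻¹ * n * g) := by
      simp [LocalAction.restrict]
    rw [this, ← AlgEquiv.mul_apply, ← AlgEquiv.mul_apply, map_mul, map_mul, map_inv]
    congr 1
    group

theorem Lift.conj_apply {N : Subgroup G} [N.Normal] (L : Lift (ρ.restrict N) π) (g : G) (r : Gam A)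
    (hr : ∀ f, PowerSeries.map π (r f) = ρ.toHom g (PowerSeries.map π f)) (n : N) :
    (L.conj g r hr).toHom n = r * L.toHom (MulAut.conjNormal (g⁻¹) n) * r⁻¹ := rfl

variable [IsLocalRing A] [IsArtinianRing A]

theorem exists_reduces (hπ : Function.Surjective π) (φ : Gam k) :
    ∃ r : Gam A, ∀ f, PowerSeries.map π (r f) = φ (PowerSeries.map π f) := by
  have h0 : constantCoeff (φ X) = 0 := (isNilpotent_constantCoeff_map_X φ).eq_zero
  have h1 : coeff 1 (φ X) ≠ 0 := (order_eq_nat.1 (order_gam_X φ)).1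
  choose s hs using hπ
  let P : A⟦X⟧ := PowerSeries.mk fun n => if n = 0 then 0 else s (coeff n (φ X))
  have hP0 : constantCoeff P = 0 := by simp [P, ← coeff_zero_eq_constantCoeff_apply]
  have hP1 : IsUnit (coeff 1 P) := by
    by_contra hu
    have h2 : coeff 1 P ∈ IsLocalRing.maximalIdeal A := by simpa using hu
    rw [← IsLocalRing.ker_eq_maximalIdeal π (fun x => ⟨s x, hs x⟩), RingHom.mem_ker] at h2
    simp [P, hs, h1] at h2
  have hPmap : PowerSeries.map π P = φ X := by
    ext n
    by_cases hn : n = 0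
    · subst hn; simpa [P] using h0.symm
    · simp [P, hn, hs]
  have hPn : IsNilpotent (constantCoeff P) := by rw [hP0]; exact IsNilpotent.zero
  let Q := P.substInvOfIsUnit hP1
  have hQn : IsNilpotent (constantCoeff Q) := by
    rw [constantCoeff_substInvOfIsUnit]; exact IsNilpotent.zero
  have hPQ : substHom P hPn (substHom Q hQn X) = X := by
    rw [substHom_X, substHom_apply]
    exact subst_substInvOfIsUnit_left P hP0 hP1
  have hQP : substHom Q hQn (substHom P hPn X) = X := by
    rw [substHom_X, substHom_apply]
    exact subst_substInvOfIsUnit_right P hP0 hP1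
  have hXn : IsNilpotent (constantCoeff (X : A⟦X⟧)) := by simp
  refine ⟨AlgEquiv.ofAlgHom (substHom P hPn) (substHom Q hQn) ?_ ?_, fun f => ?_⟩
  · exact algHom_ext_X hPQ (by rw [AlgHom.comp_apply, hPQ]; exact hXn)
  · exact algHom_ext_X hQP (by rw [AlgHom.comp_apply, hQP]; exact hXn)
  · have h2 : (φ : k⟦X⟧ →ₐ[k] k⟦X⟧) = substHom (φ X) (isNilpotent_constantCoeff_map_X φ) := by
      refine algHom_ext_X ?_ (isNilpotent_constantCoeff_map_X φ)
      simp [substHom_X]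
    have h3 := DFunLike.congr_fun h2 (PowerSeries.map π f)
    change PowerSeries.map π (substHom P hPn f) = _
    rw [AlgEquiv.coe_toAlgHom] at h3
    rw [h3, substHom_apply, substHom_apply, ← hPmap]
    exact map_subst (show HasSubst P from hPn) f

/-- The action `κ ↦ g_* κ` of `g ∈ G` on `D_N(A)`: the class of `ρ_A` is sent to the class of
`n ↦ r_g ρ_A(g⁻¹ n g) r_g⁻¹` for a chosen lift `r_g` of `ρ(g)` to `A`. -/
def Deform.conj (hπ : Function.Surjective π) (N : Subgroup G) [N.Normal] (g : G) :
    Deform (ρ.restrict N) π → Deform (ρ.restrict N) π :=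
  Quotient.map (fun L => L.conj g (exists_reduces hπ (ρ.toHom g)).choose
      (exists_reduces hπ (ρ.toHom g)).choose_spec) <| by
    rintro L L' ⟨χ, h, hL⟩
    generalize_proofs h1 h2
    generalize h1.choose = r at h2
    refine ⟨r * χ * r⁻¹, fun f => ?_, fun n => ?_⟩
    · rw [AlgEquiv.mul_apply, AlgEquiv.mul_apply, h2, h, map_inv_of_reduces h2,
        ← AlgEquiv.mul_apply, mul_inv_cancel, AlgEquiv.one_apply]
    · rw [Lift.conj_apply, Lift.conj_apply, hL]
      group

/-- The invariants `D_N(A)^{G/N}`. The action of `G` on `D_N(A)` factors through `G/N`. -/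
def DeformInv (hπ : Function.Surjective π) (ρ : LocalAction k G) (N : Subgroup G) [N.Normal] :
    Type u :=
  {κ : Deform (ρ.restrict N) π // ∀ g : G, Deform.conj hπ N g κ = κ}

theorem Deform.conj_res (hπ : Function.Surjective π) (N : Subgroup G) [N.Normal] (g : G)
    (κ : Deform ρ π) : Deform.conj hπ N g (κ.res N) = κ.res N := by
  induction κ using Quotient.inductionOn with
  | h L =>
    apply Quotient.sound
    generalize_proofs h1 h2
    generalize h1.choose = r at h2
    refine ⟨L.toHom g * r⁻¹, fun f => ?_, fun n => ?_⟩
    · rw [AlgEquiv.mul_apply, L.reduces, map_inv_of_reduces h2, ← AlgEquiv.mul_apply,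
        mul_inv_cancel, AlgEquiv.one_apply]
    · rw [Lift.conj_apply]
      have h3 : (L.restrict N).toHom (MulAut.conjNormal (g⁻¹) n) = L.toHom (g⁻¹ * n * g) := by
        simp [Lift.restrict]
      have h4 : (L.restrict N).toHom n = L.toHom n := rfl
      rw [h3, h4, map_mul, map_mul, map_inv]
      group

/-! ### Induction -/

variable [Finite G]

theorem mem_invariantRing_of_normal (N : Subgroup G) [N.Normal] (τ : G →* Gam A) (g : G) {f : A⟦X⟧}
    (hf : f ∈ invariantRing (τ.comp N.subtype)) : τ g f ∈ invariantRing (τ.comp N.subtype) := by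
  intro n
  have h := hf (MulAut.conjNormal (g⁻¹) n)
  simp only [MonoidHom.comp_apply, Subgroup.subtype_apply, MulAut.conjNormal_apply, inv_inv,
    map_mul, AlgEquiv.mul_apply] at h ⊢
  have h2 := congrArg (τ g) h
  rwa [← AlgEquiv.mul_apply (τ g), ← map_mul, mul_inv_cancel, map_one, AlgEquiv.one_apply] at h2

/-- An automorphism carrying `τ`-invariants to `τ'`-invariants, restricted to the invariants. -/
def invariantMap {H : Type u} [Group H] (τ τ' : H →* Gam A) (χ : Gam A)
    (h : ∀ f ∈ invariantRing τ, χ f ∈ invariantRing τ')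
    (h' : ∀ f ∈ invariantRing τ', χ⁻¹ f ∈ invariantRing τ) :
    invariantRing τ ≃ₐ[A] invariantRing τ' :=
  AlgEquiv.ofAlgHom
    (((χ : A⟦X⟧ →ₐ[A] A⟦X⟧).comp (invariantRing τ).val).codRestrict _ fun f => h f f.2)
    (((χ⁻¹ : Gam A) : A⟦X⟧ →ₐ[A] A⟦X⟧).comp (invariantRing τ').val |>.codRestrict _
      fun f => h' f f.2)
    (by ext1 f; exact Subtype.ext (AlgEquiv.apply_symm_apply χ f))
    (by ext1 f; exact Subtype.ext (AlgEquiv.symm_apply_apply χ f))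

/-- Such an automorphism, read on `A⟦y⟧` through `A⟦y⟧ ≃ A⟦t⟧ ^ H`. -/
def Lift.transport {H : Type u} [Group H] [Finite H] {ρ : LocalAction k H}
    (hπ : Function.Surjective π) (L L' : Lift ρ π) (χ : Gam A)
    (h : ∀ f ∈ invariantRing L.toHom, χ f ∈ invariantRing L'.toHom)
    (h' : ∀ f ∈ invariantRing L'.toHom, χ⁻¹ f ∈ invariantRing L.toHom) : Gam A :=
  (L.invariantEquiv hπ).trans
    ((invariantMap L.toHom L'.toHom χ h h').trans (L'.invariantEquiv hπ).symm)

theorem Lift.normEmb_transport {H : Type u} [Group H] [Finite H] {ρ : LocalAction k H}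
    (hπ : Function.Surjective π) (L L' : Lift ρ π) (χ : Gam A)
    (h : ∀ f ∈ invariantRing L.toHom, χ f ∈ invariantRing L'.toHom)
    (h' : ∀ f ∈ invariantRing L'.toHom, χ⁻¹ f ∈ invariantRing L.toHom) (f : A⟦X⟧) :
    normEmb L'.toHom (L.transport hπ L' χ h h' f) = χ (normEmb L.toHom f) :=
  congrArg Subtype.val ((L'.invariantEquiv hπ).apply_symm_apply
    (invariantMap L.toHom L'.toHom χ h h' (L.invariantEquiv hπ f)))

/-- The action of `g ∈ G` on the ring of `N`-invariants, transported to `A⟦y⟧`. -/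
def Lift.indAut (hπ : Function.Surjective π) (L : Lift ρ π) (N : Subgroup G) [N.Normal] (g : G) :
    Gam A :=
  (L.restrict N).transport hπ (L.restrict N) (L.toHom g)
    (fun _ hf => mem_invariantRing_of_normal N L.toHom g hf)
    (fun f hf => by
      rw [← map_inv]
      exact mem_invariantRing_of_normal N L.toHom g⁻¹ hf)

theorem Lift.normEmb_indAut (hπ : Function.Surjective π) (L : Lift ρ π) (N : Subgroup G)
    [N.Normal] (g : G) (f : A⟦X⟧) :
    normEmb (L.restrict N).toHom (L.indAut hπ N g f) =
      L.toHom g (normEmb (L.restrict N).toHom f) :=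
  Lift.normEmb_transport ..

/-- The action of `G/N` on `A⟦y⟧ ≃ A⟦t⟧ ^ N` induced by a lift `ρ_A` of `ρ`. -/
def Lift.indHom (hπ : Function.Surjective π) (L : Lift ρ π) (N : Subgroup G) [N.Normal] :
    G ⧸ N →* Gam A :=
  QuotientGroup.lift N
    { toFun := L.indAut hπ N
      map_one' := by
        ext1 f
        apply (L.restrict N).normEmb_injective hπ
        rw [L.normEmb_indAut]
        simp
      map_mul' := fun g g' => by
        ext1 f
        apply (L.restrict N).normEmb_injective hπ
        rw [AlgEquiv.mul_apply, L.normEmb_indAut, L.normEmb_indAut, L.normEmb_indAut, map_mul,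
          AlgEquiv.mul_apply] }
    fun n hn => by
      ext1 f
      apply (L.restrict N).normEmb_injective hπ
      refine (L.normEmb_indAut hπ N n f).trans ?_
      exact LocalDeformation.map_normEmb (L.restrict N).toHom ⟨n, hn⟩ f

theorem Lift.normEmb_indHom (hπ : Function.Surjective π) (L : Lift ρ π) (N : Subgroup G)
    [N.Normal] (g : G) (f : A⟦X⟧) :
    normEmb (L.restrict N).toHom (L.indHom hπ N g f) =
      L.toHom g (normEmb (L.restrict N).toHom f) :=
  L.normEmb_indAut hπ N g f

/-- The local `G/N`-action `ρ^♯` on `k⟦y⟧ ≃ k⟦t⟧ ^ N`. -/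
def LocalAction.quot (ρ : LocalAction k G) (N : Subgroup G) [N.Normal] : LocalAction k (G ⧸ N) where
  toHom := ρ.self.indHom Function.surjective_id N
  injective := by
    classical
    have := Fintype.ofFinite N
    rw [injective_iff_map_eq_one]
    intro q hq
    obtain ⟨g, rfl⟩ := QuotientGroup.mk_surjective q
    rw [QuotientGroup.eq_one_iff]
    have hfix : ∀ f ∈ invariantRing (ρ.toHom.comp N.subtype), ρ.toHom g f = f := by
      intro f hf
      obtain ⟨c, rfl⟩ := (ρ.self.restrict N).normEmb_surjective Function.surjective_id hf
      have h := ρ.self.normEmb_indHom Function.surjective_id N g c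
      rw [hq] at h
      exact h.symm
    let P : Polynomial k⟦X⟧ := ∏ n : N, (Polynomial.X - Polynomial.C (ρ.toHom n X))
    have hPN : ∀ n : N, P.map ((ρ.toHom n : k⟦X⟧ ≃ₐ[k] k⟦X⟧) : k⟦X⟧ →+* k⟦X⟧) = P := by
      intro n
      simp only [P, Polynomial.map_prod]
      refine Fintype.prod_equiv (Equiv.mulLeft n) _ _ fun m => ?_
      simp
    have hPg : P.map ((ρ.toHom g : k⟦X⟧ ≃ₐ[k] k⟦X⟧) : k⟦X⟧ →+* k⟦X⟧) = P := by
      ext1 i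
      rw [Polynomial.coeff_map]
      refine hfix _ fun n => ?_
      conv_rhs => rw [← hPN n]
      rw [Polynomial.coeff_map]
      rfl
    have h1 : P.eval (ρ.toHom g X) = 0 := by
      rw [← hPg]
      have h2 : P.eval X = 0 := by
        simp only [P, Polynomial.eval_prod]
        exact Finset.prod_eq_zero (Finset.mem_univ 1) (by simp)
      have h3 := Polynomial.eval_map_apply
        (f := ((ρ.toHom g : k⟦X⟧ ≃ₐ[k] k⟦X⟧) : k⟦X⟧ →+* k⟦X⟧)) (p := P) X
      rw [h2, map_zero] at h3
      exact h3
    simp only [P, Polynomial.eval_prod, Finset.prod_eq_zero_iff, Finset.mem_univ, true_and,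
      Polynomial.eval_sub, Polynomial.eval_X, Polynomial.eval_C, sub_eq_zero] at h1
    obtain ⟨n, hn⟩ := h1
    rw [ρ.injective (gam_ext hn)]
    exact n.2

theorem LocalAction.normEmb_quot (ρ : LocalAction k G) (N : Subgroup G) [N.Normal] (g : G)
    (f : k⟦X⟧) :
    normEmb (ρ.restrict N).toHom ((ρ.quot N).toHom g f) =
      ρ.toHom g (normEmb (ρ.restrict N).toHom f) :=
  ρ.self.normEmb_indHom Function.surjective_id N g f

/-- The lift of `ρ^♯` induced by a lift of `ρ`. -/
def Lift.ind (hπ : Function.Surjective π) (L : Lift ρ π) (N : Subgroup G) [N.Normal] :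
    Lift (ρ.quot N) π where
  toHom := L.indHom hπ N
  reduces q f := by
    obtain ⟨g, rfl⟩ := QuotientGroup.mk_surjective q
    apply (ρ.restrict N).self.normEmb_injective Function.surjective_id
    refine Eq.trans ?_ (ρ.normEmb_quot N g (PowerSeries.map π f)).symm
    refine ((L.restrict N).map_normEmb _).symm.trans ?_
    rw [L.normEmb_indHom, L.reduces, (L.restrict N).map_normEmb]

/-- The induction map `D_G(A) → D_{G/N}(A)`. -/
def Deform.ind (hπ : Function.Surjective π) (N : Subgroup G) [N.Normal] :
    Deform ρ π → Deform (ρ.quot N) π :=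
  Quotient.map (fun L => L.ind hπ N) <| by
    rintro L L' ⟨χ, h, hL⟩
    refine ⟨(L.restrict N).transport hπ (L'.restrict N) χ ?_ ?_, fun f => ?_, fun q => ?_⟩
    · intro f hf n
      have h1 : (L'.restrict N).toHom n = χ * (L.restrict N).toHom n * χ⁻¹ := hL n
      rw [h1, AlgEquiv.mul_apply, ← AlgEquiv.mul_apply χ⁻¹, inv_mul_cancel, AlgEquiv.one_apply,
        AlgEquiv.mul_apply, hf n]
    · intro f hf n
      have h1 : (L'.restrict N).toHom n = χ * (L.restrict N).toHom n * χ⁻¹ := hL n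
      have h2 := congrArg (fun z => (χ⁻¹ : Gam A) z) (hf n)
      rw [h1, ← AlgEquiv.mul_apply, ← mul_assoc, ← mul_assoc, inv_mul_cancel, one_mul,
        AlgEquiv.mul_apply] at h2
      exact h2
    · apply (ρ.restrict N).self.normEmb_injective Function.surjective_id
      refine ((L'.restrict N).map_normEmb _).symm.trans ?_
      refine (congrArg (PowerSeries.map π) (Lift.normEmb_transport hπ _ _ χ _ _ f)).trans ?_
      rw [h, (L.restrict N).map_normEmb]
      rfl
    · obtain ⟨g, rfl⟩ := QuotientGroup.mk_surjective q
      rw [_root_.eq_mul_inv_iff_mul_eq]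
      ext1 f
      apply (L'.restrict N).normEmb_injective hπ
      rw [AlgEquiv.mul_apply, AlgEquiv.mul_apply]
      refine (L'.normEmb_indHom hπ N g _).trans ?_
      refine (congrArg (L'.toHom g) (Lift.normEmb_transport hπ _ _ χ _ _ f)).trans ?_
      refine Eq.trans ?_ (Lift.normEmb_transport hπ _ _ χ _ _ _).symm
      refine Eq.trans ?_ (congrArg χ (L.normEmb_indHom hπ N g f).symm)
      rw [hL, AlgEquiv.mul_apply, ← AlgEquiv.mul_apply χ⁻¹, inv_mul_cancel, AlgEquiv.one_apply,
        AlgEquiv.mul_apply]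

/-- The morphism `Φ = (res, ind) : D_G(A) → D_N(A)^{G/N} × D_{G/N}(A)`. -/
def Deform.resInd (hπ : Function.Surjective π) (N : Subgroup G) [N.Normal] (κ : Deform ρ π) :
    DeformInv hπ ρ N × Deform (ρ.quot N) π :=
  (⟨κ.res N, fun g => Deform.conj_res hπ N g κ⟩, κ.ind hπ N)

end Deformations

section Tangent

open groupCohomology CategoryTheory

variable {k : Type u} [Field k] {G : Type u} [Group G]

/-- `Der = Der_k k⟦t⟧`. -/
abbrev Der (k : Type u) [Field k] : Type u := Derivation k k⟦X⟧ k⟦X⟧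

/-- The derivation `φ d φ⁻¹`. -/
def conjDer (φ : Gam k) : Der k →ₗ[k] Der k where
  toFun d := Derivation.mk' ((φ : k⟦X⟧ →ₗ[k] k⟦X⟧) ∘ₗ (d : k⟦X⟧ →ₗ[k] k⟦X⟧) ∘ₗ
      ((φ⁻¹ : Gam k) : k⟦X⟧ →ₗ[k] k⟦X⟧)) fun a b => by
    simp
  map_add' d e := by
    apply Derivation.ext; intro x
    exact map_add φ (d _) (e _)
  map_smul' c d := by
    apply Derivation.ext; intro x
    exact map_smul φ c (d _)

theorem conjDer_apply (φ : Gam k) (d : Der k) (x : k⟦X⟧) :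
    conjDer φ d x = φ (d ((φ⁻¹ : Gam k) x)) := rfl

/-- The action `d ↦ ρ(g) d ρ(g)⁻¹` of `G` on `Der`. -/
def derAction (ρ : LocalAction k G) : Representation k G (Der k) where
  toFun g := conjDer (ρ.toHom g)
  map_one' := by
    apply LinearMap.ext; intro d
    apply Derivation.ext; intro x
    simp [conjDer_apply]
  map_mul' g h := by
    apply LinearMap.ext; intro d
    apply Derivation.ext; intro x
    simp [conjDer_apply]

theorem derAction_apply (ρ : LocalAction k G) (g : G) (d : Der k) :
    derAction ρ g d = conjDer (ρ.toHom g) d := rfl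

/-- The `k[G]`-module `Der`. -/
abbrev DerRep (ρ : LocalAction k G) : Rep.{u} k G := Rep.of (derAction ρ)

/-- The residue map `k[ε] → k`. -/
def dualRes (k : Type u) [Field k] : DualNumber k →+* k :=
  (TrivSqZeroExt.fstHom k k k : DualNumber k →ₐ[k] k)

theorem dualRes_surjective (k : Type u) [Field k] : Function.Surjective (dualRes k) :=
  fun a => ⟨TrivSqZeroExt.inl a, rfl⟩

instance (k : Type u) [Field k] : IsArtinianRing (DualNumber k) :=
  have : Module.Finite k (DualNumber k) := inferInstanceAs (Module.Finite k (k × k))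
  IsArtinianRing.of_finite k (DualNumber k)

/-- The inclusion `k⟦t⟧ → k[ε]⟦t⟧`. -/
def inc (k : Type u) [Field k] : k⟦X⟧ →+* (DualNumber k)⟦X⟧ :=
  PowerSeries.map (TrivSqZeroExt.inlHom k k)

/-- The element `ε` of `k[ε]⟦t⟧`. -/
def epsS (k : Type u) [Field k] : (DualNumber k)⟦X⟧ := C DualNumber.eps

/-- The coefficient of `ε` of an element of `k[ε]⟦t⟧`. -/
def sndS (f : (DualNumber k)⟦X⟧) : k⟦X⟧ := PowerSeries.mk fun n => (coeff n f).snd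

/-- The residue in `k⟦t⟧` of an element of `k[ε]⟦t⟧`. -/
abbrev fstS : (DualNumber k)⟦X⟧ →+* k⟦X⟧ := PowerSeries.map (dualRes k)

theorem fstS_inc (a : k⟦X⟧) : fstS (inc k a) = a := by
  ext n; simp [inc, dualRes]

theorem sndS_inc (a : k⟦X⟧) : sndS (inc k a) = 0 := by
  ext n; simp [inc, sndS]

theorem fstS_eps : fstS (epsS k) = 0 := by
  simp [epsS, dualRes]

theorem sndS_add (f g : (DualNumber k)⟦X⟧) : sndS (f + g) = sndS f + sndS g := by
  ext n; simp [sndS]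

theorem sndS_mul (f g : (DualNumber k)⟦X⟧) :
    sndS (f * g) = fstS f * sndS g + fstS g * sndS f := by
  rw [mul_comm (fstS g)]
  ext n
  have hs : ∀ (s : Finset (ℕ × ℕ)) (F : ℕ × ℕ → DualNumber k),
      (∑ i ∈ s, F i).snd = ∑ i ∈ s, (F i).snd := fun s F =>
    map_sum (TrivSqZeroExt.sndHom k k) F s
  simp [sndS, coeff_mul, dualRes, hs, Finset.sum_add_distrib]

theorem sndS_eps_inc (b : k⟦X⟧) : sndS (epsS k * inc k b) = b := by
  ext n; simp [sndS, epsS, inc]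

theorem eq_inc_add (f : (DualNumber k)⟦X⟧) : f = inc k (fstS f) + epsS k * inc k (sndS f) := by
  ext n <;> simp [sndS, epsS, inc, dualRes]

theorem dual_ext {f g : (DualNumber k)⟦X⟧} (h1 : fstS f = fstS g) (h2 : sndS f = sndS g) :
    f = g := by
  rw [eq_inc_add f, eq_inc_add g, h1, h2]

/-- The automorphism `f ↦ φ f + ε d(φ f̄)` of `k[ε]⟦t⟧` attached to `φ` and a derivation `d`. -/
def extFun (φ : Gam k) (d : Der k) (f : (DualNumber k)⟦X⟧) : (DualNumber k)⟦X⟧ :=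
  inc k (φ (fstS f)) + epsS k * inc k (φ (sndS f) + d (φ (fstS f)))

theorem fstS_extFun (φ : Gam k) (d : Der k) (f : (DualNumber k)⟦X⟧) :
    fstS (extFun φ d f) = φ (fstS f) := by
  rw [extFun, map_add, map_mul, fstS_inc, fstS_eps, zero_mul, add_zero]

theorem sndS_extFun (φ : Gam k) (d : Der k) (f : (DualNumber k)⟦X⟧) :
    sndS (extFun φ d f) = φ (sndS f) + d (φ (fstS f)) := by
  rw [extFun, sndS_add, sndS_inc, sndS_eps_inc, zero_add]

theorem extFun_extFun (φ ψ : Gam k) (d e : Der k) (f : (DualNumber k)⟦X⟧) :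
    extFun φ d (extFun ψ e f) = extFun (φ * ψ) (d + conjDer φ e) f := by
  have h : (φ⁻¹ : Gam k) (φ (ψ (fstS f))) = ψ (fstS f) := AlgEquiv.symm_apply_apply φ _
  apply dual_ext
  · simp only [fstS_extFun, AlgEquiv.mul_apply]
  · simp only [fstS_extFun, sndS_extFun, AlgEquiv.mul_apply, map_add, Derivation.add_apply,
      conjDer_apply, h]
    ring

theorem extFun_one_zero (f : (DualNumber k)⟦X⟧) : extFun 1 0 f = f := by
  apply dual_ext
  · simp [fstS_extFun]
  · simp [sndS_extFun]

/-- `extFun φ d` as an algebra homomorphism. -/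
def extHom (φ : Gam k) (d : Der k) : (DualNumber k)⟦X⟧ →ₐ[DualNumber k] (DualNumber k)⟦X⟧ where
  toFun := extFun φ d
  map_one' := by
    apply dual_ext
    · simp [fstS_extFun]
    · have h : sndS (1 : (DualNumber k)⟦X⟧) = 0 := by
        rw [← map_one (inc k), sndS_inc]
      simp [sndS_extFun, h]
  map_mul' f g := by
    apply dual_ext
    · simp only [fstS_extFun, map_mul]
    · simp only [fstS_extFun, sndS_extFun, sndS_mul, map_mul, map_add, Derivation.leibniz,
        smul_eq_mul]
      ring
  map_zero' := by
    apply dual_ext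
    · simp [fstS_extFun]
    · have h : sndS (0 : (DualNumber k)⟦X⟧) = 0 := by
        rw [← map_zero (inc k), sndS_inc]
      simp [sndS_extFun, h]
  map_add' f g := by
    apply dual_ext
    · simp only [fstS_extFun, map_add]
    · simp only [sndS_extFun, sndS_add, map_add]
      ring
  commutes' a := by
    have h1 : fstS (algebraMap (DualNumber k) (DualNumber k)⟦X⟧ a) = C a.fst := by
      ext n; simp [dualRes, coeff_C]
    have h2 : sndS (algebraMap (DualNumber k) (DualNumber k)⟦X⟧ a) = C a.snd := by
      ext n
      simp only [sndS, coeff_mk, PowerSeries.algebraMap_apply, coeff_C, Algebra.algebraMap_self,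
        RingHom.id_apply]
      split_ifs <;> simp
    have h3 : ∀ c : k, φ (C c) = C c := fun c => by simpa using φ.commutes c
    have h4 : ∀ c : k, d (C c) = 0 := fun c => by simpa using d.map_algebraMap c
    apply dual_ext
    · rw [fstS_extFun, h1, h3]
    · rw [sndS_extFun, h1, h2, h3, h3, h4, add_zero]

/-- The automorphism `f ↦ φ f + ε d(φ f̄)` of `k[ε]⟦t⟧`. -/
def extAut (φ : Gam k) (d : Der k) : Gam (DualNumber k) :=
  AlgEquiv.ofAlgHom (extHom φ d) (extHom φ⁻¹ (- conjDer φ⁻¹ d))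
    (by
      ext1 f
      refine (extFun_extFun _ _ _ _ _).trans ?_
      have h : d + conjDer φ (- conjDer φ⁻¹ d) = 0 := by
        apply Derivation.ext; intro x
        simp [conjDer_apply]
      rw [h, mul_inv_cancel]
      exact extFun_one_zero f)
    (by
      ext1 f
      refine (extFun_extFun _ _ _ _ _).trans ?_
      rw [neg_add_cancel, inv_mul_cancel]
      exact extFun_one_zero f)

theorem extAut_apply (φ : Gam k) (d : Der k) (f : (DualNumber k)⟦X⟧) :
    extAut φ d f = extFun φ d f := rfl

theorem extAut_mul (φ ψ : Gam k) (d e : Der k) :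
    extAut φ d * extAut ψ e = extAut (φ * ψ) (d + conjDer φ e) := by
  ext1 f
  exact extFun_extFun φ ψ d e f

theorem extAut_injective (φ : Gam k) : Function.Injective (extAut φ) := by
  intro d e h
  apply Derivation.ext
  intro x
  have h1 := congrArg sndS (DFunLike.congr_fun h (inc k ((φ⁻¹ : Gam k) x)))
  have h2 : φ ((φ⁻¹ : Gam k) x) = x := AlgEquiv.apply_symm_apply φ x
  simpa only [extAut_apply, sndS_extFun, sndS_inc, fstS_inc, h2, map_zero, zero_add] using h1

/-- The derivation `d` such that `χ = extAut φ d`, for `χ` reducing to `φ`. -/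
def derOf (φ : Gam k) (χ : Gam (DualNumber k)) (h : ∀ f, fstS (χ f) = φ (fstS f)) : Der k :=
  Derivation.mk'
    { toFun := fun x => sndS (χ (inc k ((φ⁻¹ : Gam k) x)))
      map_add' := fun x y => by simp only [map_add, sndS_add]
      map_smul' := fun c x => by
        have hc : χ (inc k (C c)) = inc k (C c) := by
          simpa [inc] using χ.commutes (TrivSqZeroExt.inl c)
        have hC : (φ⁻¹ : Gam k) (C c) = C c := by simpa using (φ⁻¹ : Gam k).commutes c
        simp only [smul_eq_C_mul, map_mul, hc, hC, sndS_mul, sndS_inc, fstS_inc, mul_zero,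
          add_zero, RingHom.id_apply] }
    fun a b => by
      simp [sndS_mul, h, fstS_inc]

theorem extAut_derOf (φ : Gam k) (χ : Gam (DualNumber k)) (h : ∀ f, fstS (χ f) = φ (fstS f)) :
    extAut φ (derOf φ χ h) = χ := by
  ext1 f
  have h0 : (φ⁻¹ : Gam k) (φ (fstS f)) = fstS f := AlgEquiv.symm_apply_apply φ _
  have h1 : derOf φ χ h (φ (fstS f)) = sndS (χ (inc k (fstS f))) := by
    conv_rhs => rw [← h0]
    rfl
  have he : χ (epsS k) = epsS k := by simpa [epsS] using χ.commutes DualNumber.eps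
  apply dual_ext
  · rw [extAut_apply, fstS_extFun, h]
  · rw [extAut_apply, sndS_extFun, h1]
    conv_rhs => rw [eq_inc_add f]
    have h2 : sndS (epsS k * χ (inc k (sndS f))) = φ (sndS f) := by
      rw [sndS_mul, fstS_eps, zero_mul, zero_add, h, fstS_inc]
      have : sndS (epsS k) = 1 := by
        have := sndS_eps_inc (k := k) 1
        rwa [map_one, mul_one] at this
      rw [this, mul_one]
    rw [map_add, map_mul, he, sndS_add, h2, add_comm]

/-- The one-cocycle `d : G → Der` of a lift of `ρ` to `k[ε]`: `ρ_A(g)(f) = ρ(g) f + ε d_g(ρ(g) f)`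
for `f ∈ k⟦t⟧`. -/
def Lift.cocycle {ρ : LocalAction k G} (L : Lift ρ (dualRes k)) : cocycles₁ (DerRep ρ) :=
  ⟨fun g => derOf (ρ.toHom g) (L.toHom g) (L.reduces g), by
    rw [mem_cocycles₁_iff]
    intro g h
    apply extAut_injective (ρ.toHom (g * h))
    change extAut (ρ.toHom (g * h)) (derOf _ _ (L.reduces (g * h))) =
      extAut (ρ.toHom (g * h)) (conjDer (ρ.toHom g) (derOf _ _ (L.reduces h)) +
        derOf _ _ (L.reduces g))
    rw [extAut_derOf, add_comm, map_mul ρ.toHom, ← extAut_mul, extAut_derOf, extAut_derOf, map_mul]⟩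

theorem Lift.toHom_eq {ρ : LocalAction k G} (L : Lift ρ (dualRes k)) (g : G) :
    L.toHom g = extAut (ρ.toHom g) (L.cocycle g) :=
  (extAut_derOf _ _ (L.reduces g)).symm

/-- The lift of `ρ` to `k[ε]` attached to a one-cocycle. -/
def Lift.ofCocycle {ρ : LocalAction k G} (d : cocycles₁ (DerRep ρ)) : Lift ρ (dualRes k) where
  toHom :=
    { toFun := fun g => extAut (ρ.toHom g) (d g)
      map_one' := by
        ext1 f
        rw [cocycles₁_map_one, map_one]
        exact extFun_one_zero f
      map_mul' := fun g h => by
        have h1 : d (g * h) = conjDer (ρ.toHom g) (d h) + d g :=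
          (mem_cocycles₁_iff d.1).1 d.2 g h
        rw [extAut_mul, ← map_mul, h1, add_comm] }
  reduces g f := fstS_extFun _ _ _

theorem Lift.cocycle_ofCocycle {ρ : LocalAction k G} (d : cocycles₁ (DerRep ρ)) :
    (Lift.ofCocycle d).cocycle = d := by
  apply cocycles₁_ext
  intro g
  exact extAut_injective (ρ.toHom g) ((Lift.ofCocycle d).toHom_eq g).symm

theorem Lift.equiv_iff {ρ : LocalAction k G} (L L' : Lift ρ (dualRes k)) :
    L ≈ L' ↔ H1π (DerRep ρ) L.cocycle = H1π (DerRep ρ) L'.cocycle := by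
  have key : ∀ (c : Der k) (g : G), L'.toHom g = extAut 1 c * L.toHom g * (extAut 1 c)⁻¹ ↔
      L'.cocycle g = c + L.cocycle g - conjDer (ρ.toHom g) c := by
    intro c g
    have hc : conjDer (1 : Gam k) = LinearMap.id := rfl
    rw [_root_.eq_mul_inv_iff_mul_eq, L.toHom_eq, L'.toHom_eq, extAut_mul, extAut_mul, mul_one,
      one_mul, (extAut_injective _).eq_iff, eq_sub_iff_add_eq, hc]
    rfl
  rw [H1π_eq_iff]
  constructor
  · rintro ⟨χ, h, hL⟩
    refine ⟨derOf 1 χ h, funext fun g => ?_⟩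
    have h1 := hL g
    rw [← extAut_derOf 1 χ h, key] at h1
    change conjDer (ρ.toHom g) _ - _ = L.cocycle g - L'.cocycle g
    rw [h1]
    abel
  · rintro ⟨c, hc⟩
    refine ⟨extAut 1 c, fun f => fstS_extFun 1 c f, fun g => ?_⟩
    rw [key]
    have h1 : conjDer (ρ.toHom g) c - c = L.cocycle g - L'.cocycle g := congrFun hc g
    rw [sub_eq_sub_iff_add_eq_add] at h1
    rw [eq_sub_iff_add_eq, add_comm, h1, add_comm]

/-- The bijection `D_ρ(k[ε]) ≃ H¹(G, Der)`, which sends the class of the lift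
`ρ_A(g) = (1 + ε d_g) ρ(g)` to the class of the cocycle `d`. -/
def tangentEquiv (ρ : LocalAction k G) : Deform ρ (dualRes k) ≃ H1 (DerRep ρ) :=
  Equiv.ofBijective
    (Quotient.lift (fun L => H1π (DerRep ρ) L.cocycle) fun L L' h => (L.equiv_iff L').1 h) <| by
    constructor
    · intro x y
      induction x using Quotient.inductionOn with | h L =>
      induction y using Quotient.inductionOn with | h L' =>
      exact fun h => Quotient.sound ((L.equiv_iff L').2 h)
    · intro c
      induction c using H1_induction_on with | h d =>
      exact ⟨Quotient.mk _ (Lift.ofCocycle d),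
        congrArg (H1π (DerRep ρ)) (Lift.cocycle_ofCocycle d)⟩

end Tangent

section Devissage

open groupCohomology CategoryTheory

variable {k : Type u} [Field k] {G : Type u} [Group G] [Finite G]

/-! ### The different -/

/-- The action of `G` on `k⟦t⟧`. -/
def ringAction (ρ : LocalAction k G) : Representation k G k⟦X⟧ where
  toFun g := (ρ.toHom g).toLinearMap
  map_one' := by ext1 f; simp
  map_mul' g h := by ext1 f; simp

theorem ringAction_apply (ρ : LocalAction k G) (g : G) (f : k⟦X⟧) :
    ringAction ρ g f = ρ.toHom g f := rfl

/-- The ring `k⟦t⟧ ^ N`. -/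
abbrev invN (ρ : LocalAction k G) (N : Subgroup G) : Subalgebra k k⟦X⟧ :=
  invariantRing (ρ.restrict N).toHom

/-- The ring `k⟦t⟧ ^ G`, as a subring of `k⟦t⟧ ^ N`. -/
def invG (ρ : LocalAction k G) (N : Subgroup G) : Subalgebra k (invN ρ N) :=
  (invariantRing ρ.toHom).comap (invN ρ N).val

instance (ρ : LocalAction k G) (N : Subgroup G) : IsPrincipalIdealRing (invN ρ N) :=
  IsPrincipalIdealRing.of_surjective
    ((ρ.restrict N).self.invariantEquiv Function.surjective_id)
    ((ρ.restrict N).self.invariantEquiv Function.surjective_id).surjective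

/-- The ideal `Der_1 = 𝔇 k⟦t⟧`, where `𝔇` is the different of `k⟦t⟧ ^ N` over `k⟦t⟧ ^ G`. -/
def Der1 (ρ : LocalAction k G) (N : Subgroup G) : Ideal k⟦X⟧ :=
  (differentIdeal (invG ρ N) (invN ρ N)).map (invN ρ N).val

variable (ρ : LocalAction k G) (N : Subgroup G) [N.Normal]

/-- The action of `g ∈ G` on `k⟦t⟧ ^ N`. -/
def actN (g : G) : invN ρ N ≃ₐ[invG ρ N] invN ρ N :=
  let e := invariantMap (ρ.restrict N).toHom (ρ.restrict N).toHom (ρ.toHom g)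
    (fun _ hf => mem_invariantRing_of_normal N ρ.toHom g hf)
    (fun _ hf => by
      rw [← map_inv]
      exact mem_invariantRing_of_normal N ρ.toHom g⁻¹ hf)
  AlgEquiv.ofRingEquiv (f := (e : invN ρ N ≃+* invN ρ N)) fun x => Subtype.ext (x.2 g)

theorem coe_actN (g : G) (x : invN ρ N) : (actN ρ N g x : k⟦X⟧) = ρ.toHom g x := rfl

theorem differentIdeal_stable {A B : Type u} [CommRing A] [CommRing B] [Algebra A B]
    [IsDomain A] [IsDedekindDomain B] [Module.IsTorsionFree A B] (σ : B ≃ₐ[A] B) {x : B}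
    (hx : x ∈ differentIdeal A B) : σ x ∈ differentIdeal A B := by
  let _ : Algebra (FractionRing A) (FractionRing B) := FractionRing.liftAlgebra A (FractionRing B)
  have : IsScalarTower A (FractionRing A) (FractionRing B) :=
    FractionRing.isScalarTower_liftAlgebra A (FractionRing B)
  let τ := IsFractionRing.fieldEquivOfAlgEquiv (FractionRing A) (FractionRing B) (FractionRing B) σ
  have hτ : ∀ b : B, τ (algebraMap B (FractionRing B) b) = algebraMap B (FractionRing B) (σ b) :=
    fun b => IsFractionRing.fieldEquivOfAlgEquiv_algebraMap (FractionRing A) (FractionRing B)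
      (FractionRing B) σ b
  have hτ' : ∀ b : B, τ.symm (algebraMap B (FractionRing B) (σ b)) =
      algebraMap B (FractionRing B) b := fun b => by rw [← hτ, AlgEquiv.symm_apply_apply]
  rw [differentIdeal, Submodule.mem_comap, Submodule.mem_div_iff_forall_mul_mem] at hx ⊢
  intro y hy
  rw [Algebra.linearMap_apply] at hx ⊢
  have hy' : τ.symm y ∈ Submodule.traceDual A (FractionRing A) (1 : Submodule B (FractionRing B)) := by
    rw [Submodule.mem_traceDual] at hy ⊢
    intro a ha
    obtain ⟨b, rfl⟩ := Submodule.mem_one.1 ha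
    have h1 := hy _ (Submodule.mem_one.2 ⟨σ b, rfl⟩)
    rw [Algebra.traceForm_apply] at h1 ⊢
    rwa [← hτ', ← map_mul, Algebra.trace_eq_of_algEquiv]
  obtain ⟨b, hb⟩ := Submodule.mem_one.1 (hx _ hy')
  refine Submodule.mem_one.2 ⟨σ b, ?_⟩
  rw [← hτ, hb, map_mul, hτ, AlgEquiv.apply_symm_apply]

theorem Der1_stable (g : G) : ∀ x ∈ Der1 ρ N, ρ.toHom g x ∈ Der1 ρ N := by
  intro x hx
  have h : Der1 ρ N ≤ (Der1 ρ N).comap (ρ.toHom g : k⟦X⟧ →+* k⟦X⟧) := by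
    rw [Der1, Ideal.map_le_iff_le_comap]
    intro y hy
    exact Ideal.mem_map_of_mem (invN ρ N).val (differentIdeal_stable (actN ρ N g) hy)
  exact h hx

/-- The embedding `Der → k⟦t⟧`, `d ↦ d(y_G)`. -/
def theta : Der k →ₗ[k] k⟦X⟧ where
  toFun d := d (normX ρ.toHom)
  map_add' _ _ := rfl
  map_smul' _ _ := rfl

/-- The embedding `Der^♯ → k⟦t⟧ ^ N ⊆ k⟦t⟧`, `d ↦ d(y_G)`. Here `Der^♯ = Der_k k⟦y⟧`, and `y_G` is
the element `∏_{q ∈ G/N} ρ^♯(q)(y)` of `k⟦y⟧ ≃ k⟦t⟧ ^ N`. -/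
def thetaSharp : Der k →ₗ[k] k⟦X⟧ where
  toFun d := normEmb (ρ.restrict N).toHom (d (normX (ρ.quot N).toHom))
  map_add' _ _ := by simp
  map_smul' _ _ := by simp

/-- The element `y_G` computed in `k⟦y⟧` is the element `y_G` of `k⟦t⟧`. -/
theorem normEmb_normX_quot :
    normEmb (ρ.restrict N).toHom (normX (ρ.quot N).toHom) = normX ρ.toHom := by
  classical
  have := Fintype.ofFinite G
  have hX : normEmb (ρ.restrict N).toHom X = ∏ n : N, ρ.toHom n X := by
    rw [normEmb, substHom_X, normX, finprod_eq_prod_of_fintype]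
    rfl
  have hq : ∀ q : G ⧸ N, normEmb (ρ.restrict N).toHom ((ρ.quot N).toHom q X) =
      ∏ n : N, ρ.toHom (q.out * n) X := by
    intro q
    conv_lhs => rw [← q.out_eq']
    refine (ρ.normEmb_quot N q.out X).trans ?_
    rw [hX, map_prod]
    exact Finset.prod_congr rfl fun n _ => by rw [map_mul, AlgEquiv.mul_apply]
  rw [normX, normX, finprod_eq_prod_of_fintype, finprod_eq_prod_of_fintype, map_prod,
    Finset.prod_congr rfl fun q _ => hq q, ← Fintype.prod_prod_type']
  refine Fintype.prod_bijective (fun q : (G ⧸ N) × N => q.1.out * (q.2 : G)) ⟨?_, fun g => ?_⟩ _ _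
    fun q => rfl
  · rintro ⟨q, n⟩ ⟨q', n'⟩ h
    have h1 := congrArg (fun g : G => (g : G ⧸ N)) h
    simp only [QuotientGroup.mk_mul_of_mem _ n.2, QuotientGroup.mk_mul_of_mem _ n'.2,
      QuotientGroup.out_eq'] at h1
    subst h1
    exact Prod.ext rfl (Subtype.ext (mul_left_cancel h))
  · refine ⟨((g : G ⧸ N), ⟨(g : G ⧸ N).out⁻¹ * g, ?_⟩), by simp⟩
    rw [← QuotientGroup.eq, QuotientGroup.out_eq']

theorem theta_conj (g : G) (d : Der k) : theta ρ (derAction ρ g d) = ρ.toHom g (theta ρ d) := by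
  change ρ.toHom g (d ((ρ.toHom g)⁻¹ (normX ρ.toHom))) = ρ.toHom g (d (normX ρ.toHom))
  rw [← map_inv, map_normX]

/-! ### The module `Der_1^N / Der^N` -/

/-- `Der_1^N`, as a subspace of `k⟦t⟧`. -/
def Der1N : Submodule k k⟦X⟧ :=
  (Der1 ρ N).restrictScalars k ⊓ (invN ρ N).toSubmodule

theorem Der1N_stable (g : G) : Der1N ρ N ≤ (Der1N ρ N).comap (ringAction ρ g) :=
  fun _ hx => ⟨Der1_stable ρ N g _ hx.1, mem_invariantRing_of_normal N ρ.toHom g hx.2⟩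

/-- The action of `G` on `Der_1^N`. -/
def der1NAction : Representation k G (Der1N ρ N) :=
  (ringAction ρ).subrepresentation (Der1N ρ N) (Der1N_stable ρ N)

/-- `Der^N` as a subspace of `Der_1^N`, through `d ↦ d(y_G)`. -/
def DerN : Submodule k (Der1N ρ N) :=
  (LinearMap.range (theta ρ)).comap (Der1N ρ N).subtype

theorem DerN_stable (g : G) : DerN ρ N ≤ (DerN ρ N).comap (der1NAction ρ N g) := by
  rintro x ⟨d, hd⟩
  refine ⟨derAction ρ g d, ?_⟩
  rw [theta_conj, hd]
  rfl

/-- The action of `G` on `Der_1^N / Der^N`; the subgroup `N` acts trivially. -/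
def quotAction : Representation k G (Der1N ρ N ⧸ DerN ρ N) :=
  (der1NAction ρ N).quotient (DerN ρ N) (DerN_stable ρ N)

/-- The map `Der_1^G = (Der_1^N)^{G/N} → (Der_1^N / Der^N)^{G/N}`. -/
def invariantsMap : (der1NAction ρ N).invariants →ₗ[k] (quotAction ρ N).invariants :=
  ((DerN ρ N).mkQ ∘ₗ (der1NAction ρ N).invariants.subtype).codRestrict _ fun x g =>
    congrArg (DerN ρ N).mkQ (x.2 g)

/-- `coker (Der_1^G → (Der_1^N / Der^N)^{G/N})`. -/
abbrev CokerInv : Type u :=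
  (quotAction ρ N).invariants ⧸ LinearMap.range (invariantsMap ρ N)

/-! ### The module `Der^♯ / Der^N` -/

/-- The image of the embedding `Der^N → Der^♯` given by restriction of derivations to `k⟦t⟧ ^ N`. -/
def DerNSharp : Submodule k (Der k) where
  carrier := {D | ∃ d : Der k, (∀ n ∈ N, derAction ρ n d = d) ∧
    ∀ u, normEmb (ρ.restrict N).toHom (D u) = d (normEmb (ρ.restrict N).toHom u)}
  add_mem' := by
    rintro D D' ⟨d, hd, h⟩ ⟨d', hd', h'⟩
    refine ⟨d + d', fun n hn => ?_, fun u => ?_⟩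
    · rw [map_add, hd n hn, hd' n hn]
    · rw [Derivation.add_apply, Derivation.add_apply, map_add, h, h']
  zero_mem' := ⟨0, by simp, by simp⟩
  smul_mem' := by
    rintro c D ⟨d, hd, h⟩
    refine ⟨c • d, fun n hn => ?_, fun u => ?_⟩
    · rw [map_smul, hd n hn]
    · rw [Derivation.smul_apply, Derivation.smul_apply, map_smul, h]

theorem DerNSharp_stable (q : G ⧸ N) :
    DerNSharp ρ N ≤ (DerNSharp ρ N).comap ((DerRep (ρ.quot N)).ρ q) := by
  obtain ⟨g, rfl⟩ := QuotientGroup.mk_surjective q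
  rintro D ⟨d, hd, h⟩
  refine ⟨derAction ρ g d, fun n hn => ?_, fun u => ?_⟩
  · have h1 := hd (g⁻¹ * n * g) (by simpa using ‹N.Normal›.conj_mem n hn g⁻¹)
    rw [← Module.End.mul_apply, ← map_mul]
    conv_rhs => rw [← h1, ← Module.End.mul_apply, ← map_mul]
    congr 2
    group
  · change normEmb _ ((ρ.quot N).toHom g (D (((ρ.quot N).toHom g)⁻¹ u))) =
      ρ.toHom g (d ((ρ.toHom g)⁻¹ (normEmb _ u)))
    rw [ρ.normEmb_quot, h, ← map_inv, ← map_inv, ← QuotientGroup.mk_inv, ρ.normEmb_quot]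

/-- The `k[G/N]`-module `Der^♯ / Der^N`. -/
abbrev DerSharpQuot : Rep.{u} k (G ⧸ N) :=
  (DerRep (ρ.quot N)).quotient (DerNSharp ρ N) (DerNSharp_stable ρ N)

/-- The map `σ : H¹(G/N, Der^♯) → H¹(G/N, Der^♯/Der^N)`. -/
def sigma : H1 (DerRep (ρ.quot N)) →ₗ[k] H1 (DerSharpQuot ρ N) :=
  (groupCohomology.map (MonoidHom.id (G ⧸ N))
    ((DerRep (ρ.quot N)).mkQ (DerNSharp ρ N) (DerNSharp_stable ρ N)) 1).hom

/-! ### The invariants `H¹(N, Der)^{G/N}` -/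

/-- The action of `g ∈ G` on `H¹(N, Der)`, induced by the maps `n ↦ g⁻¹ n g` on `N` and
`d ↦ ρ(g) d ρ(g)⁻¹` on `Der`. -/
def conjH1 (g : G) : H1 (DerRep (ρ.restrict N)) →ₗ[k] H1 (DerRep (ρ.restrict N)) :=
  (groupCohomology.map (A := DerRep (ρ.restrict N)) (B := DerRep (ρ.restrict N))
    (MulAut.conjNormal (g⁻¹) : MulAut N).toMonoidHom
    (Rep.ofHom ⟨derAction ρ g, fun n => by
      have h : (ρ.toHom g) * (ρ.restrict N).toHom (MulAut.conjNormal (g⁻¹) n) =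
          (ρ.restrict N).toHom n * ρ.toHom g := by
        simp only [LocalAction.restrict, MonoidHom.comp_apply, Subgroup.subtype_apply,
          MulAut.conjNormal_apply, inv_inv, ← map_mul]
        congr 1
        group
      apply LinearMap.ext; intro d
      apply Derivation.ext; intro x
      have h' := congrArg (fun z : Gam k => z⁻¹ x) h
      have h2 := DFunLike.congr_fun h (d ((ρ.toHom g)⁻¹ (((ρ.restrict N).toHom n)⁻¹ x)))
      simp only [mul_inv_rev, AlgEquiv.mul_apply] at h' h2
      change ρ.toHom g ((ρ.restrict N).toHom (MulAut.conjNormal (g⁻¹) n)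
        (d (((ρ.restrict N).toHom (MulAut.conjNormal (g⁻¹) n))⁻¹ ((ρ.toHom g)⁻¹ x)))) =
        (ρ.restrict N).toHom n (ρ.toHom g (d ((ρ.toHom g)⁻¹ (((ρ.restrict N).toHom n)⁻¹ x))))
      rw [h', h2]⟩) 1).hom

/-- `H¹(N, Der)^{G/N}`. The action of `G` on `H¹(N, Der)` factors through `G/N`. -/
def H1Inv : Submodule k (H1 (DerRep (ρ.restrict N))) :=
  ⨅ g : G, LinearMap.eqLocus (conjH1 ρ N g) LinearMap.id

/-- The graph of the map `γ : H¹(N, Der)^{G/N} → H¹(G/N, Der^♯/Der^N)`, the negative of the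
connecting map of `0 → Der_1^N/Der^N → (Der_1/Der)^N → H¹(N, Der) → 0`. Let `κ` be the class of
`d`, write `d_s = α^s - α` for `s ∈ N` with `α ∈ Der_1`, and `α^g - α = a_g + b_g` for `g ∈ G`
with `a_g ∈ Der_1^N = Der^♯` and `b_g ∈ Der`. Then `γ(κ)` is minus the class of `a_g`. -/
def GammaGraph (κ : H1Inv ρ N) (c : H1 (DerSharpQuot ρ N)) : Prop :=
  ∃ (d : cocycles₁ (DerRep (ρ.restrict N))) (α : k⟦X⟧) (a b : G → Der k)
    (z : cocycles₁ (DerSharpQuot ρ N)),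
    H1π _ d = (κ : H1 (DerRep (ρ.restrict N))) ∧ α ∈ Der1 ρ N ∧
    (∀ s : N, theta ρ (d s) = ρ.toHom s α - α) ∧
    (∀ g : G, ρ.toHom g α - α = thetaSharp ρ N (a g) + theta ρ (b g)) ∧
    (∀ g : G, z (g : G ⧸ N) = (DerNSharp ρ N).mkQ (a g)) ∧
    c = - H1π _ z

end Devissage

end LocalDeformation

end

open LocalDeformation groupCohomology

/-! Write y = y_N, z = y_G, and ∂f for the function g ↦ f^g - f. Evaluation at z embeds Der and
Der^♯ equivariantly in k⟦t⟧ (`theta`, `thetaSharp`), so cocycles become k⟦t⟧-valued functions on the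
group and the argument takes place inside k⟦t⟧.

The arithmetic input is that the different of k⟦y⟧ over k⟦z⟧ is generated by dz/dy
(`differentIdeal_invN`). Hence Der_1 = (dz/dy) k⟦t⟧ contains, by the chain rule, the value at z of
every derivation along k⟦y⟧ ⊆ k⟦t⟧. In particular it contains Der and Der^♯, and its N-invariants
are exactly Der^♯ (`mem_Der1N_iff`).

The deformation input: a lift to k[ε] deforms the embedding k⟦y⟧ → k⟦t⟧ to first order. Minus the
ε-part is a derivation along that embedding; let α ∈ Der_1 be its value at z. Comparing ε-parts
shows that the cocycle of a lift of the N-action is ∂α on N (`exists_mem_Der1_coboundary`), and that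
a lift of the G-action with cocycle c induces the cocycle e = c - ∂α of G/N
(`Lift.thetaSharp_cocycle_ind`). The class of e depends only on that of c: since e vanishes on N, α
is determined by c up to an element of Der^♯. So induction on tangent spaces is given by the
relation `IndRel`.

The rest is a diagram chase with e = c - ∂α. If c = ∂m on N and e = ∂u, then b = u + α - m lies in
Der_1^N and c is cohomologous to ∂b; this gives the kernel (`exists_cobRel_iff`). For the image, ∂α
= -e + c exhibits a = -e in the definition of γ, whence γ(res) = σ(ind) (`IndRel.gamma_eq_sigma`).
Conversely, γ(κ) = σ(λ) permits α to be corrected by an element of Der^♯ until e + ∂α takes values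
in Der, and this is the required cocycle (`exists_indRel_of_gammaGraph`). -/

noncomputable section

namespace LocalDeformation

/-! ### The different of a monogenic extension with distinct conjugates. -/

section DifferentOfMonogenic

variable {A B : Type u} [CommRing A] [CommRing B] [Algebra A B] [IsDomain A] 
  [FaithfulSMul A B] [IsIntegrallyClosed A] {ι : Type*} [Fintype ι] {v : ι → B}
  {P : Polynomial A}

/-- A monic polynomial whose roots are pairwise distinct conjugates of `y` is the minimal
polynomial of `y`. -/
theorem minpoly_eq_of_conjugates [IsDomain B] (hv : Function.Injective v)
    (hP : P.map (algebraMap A B) = ∏ i, (Polynomial.X - Polynomial.C (v i)))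
    {y : B} (hy : y ∈ Set.range v) (hσ : ∀ i, ∃ σ : B ≃ₐ[A] B, σ y = v i) :
    minpoly A y = P := by
  have hmon : P.Monic := by
    refine Polynomial.monic_of_injective (FaithfulSMul.algebraMap_injective A B) ?_
    rw [hP]
    exact Polynomial.monic_prod_of_monic _ _ fun i _ => Polynomial.monic_X_sub_C _
  have hPy : Polynomial.aeval y P = 0 := by
    obtain ⟨i, rfl⟩ := hy
    rw [Polynomial.aeval_def, ← Polynomial.eval_map, hP, Polynomial.eval_prod]
    exact Finset.prod_eq_zero (Finset.mem_univ i) (by simp)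
  have hint : IsIntegral A y := ⟨P, hmon, by simpa [Polynomial.aeval_def] using hPy⟩
  -- The minimal polynomial divides `P`, so it remains to bound its degree from below by the number
  -- of conjugates.
  refine (Polynomial.eq_of_monic_of_dvd_of_natDegree_le (minpoly.monic hint) hmon
    (minpoly.isIntegrallyClosed_dvd hint hPy) ?_).symm
  have hcard : P.natDegree = Fintype.card ι := by
    rw [← Polynomial.natDegree_map_eq_of_injective (FaithfulSMul.algebraMap_injective A B), hP,
      Polynomial.natDegree_prod_of_monic _ _ fun i _ => Polynomial.monic_X_sub_C _]
    simp
  rw [hcard, ← Polynomial.natDegree_map_eq_of_injective (FaithfulSMul.algebraMap_injective A B)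
    (minpoly A y)]
  classical
  have h0 : (minpoly A y).map (algebraMap A B) ≠ 0 := ((minpoly.monic hint).map _).ne_zero
  -- An automorphism over `A` carries the root `y` to another root, so all the distinct `v i` are
  -- roots.
  have hsub : (Finset.univ.image v).val ≤ ((minpoly A y).map (algebraMap A B)).roots := by
    rw [Finset.val_le_iff_val_subset]
    intro b hb
    obtain ⟨i, -, rfl⟩ := Finset.mem_image.1 hb
    obtain ⟨σ, hσ⟩ := hσ i
    rw [Polynomial.mem_roots h0, Polynomial.IsRoot, Polynomial.eval_map,
      ← Polynomial.aeval_def, ← hσ, ← AlgEquiv.coe_toAlgHom, Polynomial.aeval_algHom_apply,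
      minpoly.aeval, map_zero]
  refine le_trans ?_ (Polynomial.card_roots' ((minpoly A y).map (algebraMap A B)))
  refine le_trans (le_of_eq ?_) (Multiset.card_le_card hsub)
  change _ = (Finset.univ.image v).card
  rw [Finset.card_image_of_injective _ hv, Finset.card_univ]

/-- The different of `A[y]` over `A`, where the conjugates of `y` are pairwise distinct. -/
theorem differentIdeal_eq_span_of_conjugates [IsDedekindDomain B] (hv : Function.Injective v)
    (hP : P.map (algebraMap A B) = ∏ i, (Polynomial.X - Polynomial.C (v i)))
    {y : B} (hy : y ∈ Set.range v) (hσ : ∀ i, ∃ σ : B ≃ₐ[A] B, σ y = v i)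
    (hgen : Algebra.adjoin A {y} = ⊤) :
    differentIdeal A B = Ideal.span
      {(Polynomial.derivative (∏ i, (Polynomial.X - Polynomial.C (v i)))).eval y} := by
  have hmin := minpoly_eq_of_conjugates hv hP hy hσ
  -- For a non-integral element `minpoly` is zero by convention, whereas `P` maps to a monic
  -- polynomial.
  have hint : IsIntegral A y := by
    by_contra h
    rw [minpoly.eq_zero h] at hmin
    rw [← hmin, Polynomial.map_zero] at hP
    exact (Polynomial.monic_prod_of_monic _ _ fun i _ => Polynomial.monic_X_sub_C _).ne_zero hP.symm
  have : Algebra.IsIntegral A B := ⟨fun b => by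
    have hb : b ∈ Algebra.adjoin A {y} := hgen ▸ Algebra.mem_top
    exact adjoin_le_integralClosure hint hb⟩
  let K := FractionRing A
  let L := FractionRing B
  let _ : Algebra K L := FractionRing.liftAlgebra A L
  have : IsScalarTower A K L := FractionRing.isScalarTower_liftAlgebra A L
  have hyK : IsIntegral K (algebraMap B L y) := (hint.map (IsScalarTower.toAlgHom A B L)).tower_top
  -- Every element of `L` is a quotient of two elements of B = A[y].
  have htop : IntermediateField.adjoin K {algebraMap B L y} = ⊤ := by
    rw [eq_top_iff]
    rintro l -
    have hB : ∀ b : B, algebraMap B L b ∈ IntermediateField.adjoin K {algebraMap B L y} := by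
      intro b
      have hb : b ∈ Algebra.adjoin A {y} := hgen ▸ Algebra.mem_top
      induction hb using Algebra.adjoin_induction with
      | mem x hx =>
        rw [Set.mem_singleton_iff.1 hx]
        exact IntermediateField.mem_adjoin_simple_self K _
      | algebraMap a =>
        rw [← IsScalarTower.algebraMap_apply A B L, IsScalarTower.algebraMap_apply A K L]
        exact IntermediateField.algebraMap_mem _ _
      | add _ _ _ _ h h' => rw [map_add]; exact add_mem h h'
      | mul _ _ _ _ h h' => rw [map_mul]; exact mul_mem h h'
    obtain ⟨a, b, -, rfl⟩ := IsFractionRing.div_surjective B l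
    exact div_mem (hB a) (hB b)
  have : FiniteDimensional K L := by
    have := IntermediateField.adjoin.finiteDimensional hyK
    rw [htop] at this
    exact IntermediateField.topEquiv.toLinearEquiv.finiteDimensional
  -- The minimal polynomial of the generator over `K` is still `P`, and its roots `v i` remain
  -- distinct in `L`.
  have : Algebra.IsSeparable K L := by
    rw [← separableClosure.eq_top_iff, eq_top_iff, ← htop, IntermediateField.adjoin_simple_le_iff,
      mem_separableClosure_iff, IsSeparable, minpoly.isIntegrallyClosed_eq_field_fractions K L hint,
      hmin, ← Polynomial.separable_map (algebraMap K L), Polynomial.map_map,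
      ← IsScalarTower.algebraMap_eq A K L, IsScalarTower.algebraMap_eq A B L, ← Polynomial.map_map,
      hP]
    simp only [Polynomial.map_prod, Polynomial.map_sub, Polynomial.map_X, Polynomial.map_C]
    exact Polynomial.separable_prod_X_sub_C_iff.2 ((IsFractionRing.injective B L).comp hv)
  have : IsIntegralClosure B A L := IsIntegralClosure.of_isIntegrallyClosed B A L
  have hadj : Algebra.adjoin K {algebraMap B L y} = ⊤ := by
    rw [← IntermediateField.adjoin_simple_toSubalgebra_of_isAlgebraic hyK.isAlgebraic, htop]
    rfl
  -- Conductor times different is (f'(y)), with f the minimal polynomial; the conductor is trivial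
  -- because B = A[y].
  have h := conductor_mul_differentIdeal A K L y hadj
  rwa [conductor_eq_top_of_adjoin_eq_top hgen, Ideal.top_mul, Polynomial.aeval_def,
    ← Polynomial.eval_map, ← Polynomial.derivative_map, hmin, hP] at h

end DifferentOfMonogenic

/-! ### Derivations of k⟦t⟧ and the derivative of the norm. -/

section Derivatives

variable {k : Type u} [Field k]

/-- The chain rule for a derivation along a homomorphism of power series rings. -/
theorem chain_rule (φ : k⟦X⟧ →ₐ[k] k⟦X⟧) (hφ : IsNilpotent (constantCoeff (φ X)))
    (D : k⟦X⟧ →ₗ[k] k⟦X⟧) (hD : ∀ f g, D (f * g) = φ f * D g + φ g * D f) (f : k⟦X⟧) :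
    D f = φ (derivative k f) * D X := by
  -- The defect of the chain rule, itself a derivation along `φ`.
  let E : k⟦X⟧ →ₗ[k] k⟦X⟧ :=
    D - (LinearMap.mulRight k (D X)) ∘ₗ φ.toLinearMap ∘ₗ (derivative k : k⟦X⟧ →ₗ[k] k⟦X⟧)
  have hE : ∀ f, E f = D f - φ (derivative k f) * D X := fun f => rfl
  have hmul : ∀ f g, E (f * g) = φ f * E g + φ g * E f := by
    intro f g
    simp only [hE, hD, Derivation.leibniz, smul_eq_mul, map_add, map_mul]
    ring
  have hX : E X = 0 := by simp [hE]
  have hC : ∀ c, E (C c) = 0 := by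
    intro c
    have h1 : E 1 = 0 := by simpa using hmul 1 1
    have h2 : C c = c • (1 : k⟦X⟧) := by rw [smul_eq_C_mul, mul_one]
    rw [h2, map_smul, h1, smul_zero]
  -- `E` kills constants and `X`, so writing f = X g + c leaves only φ(X) E(g). Iterating, E(f) is
  -- divisible by every power of φ(X), hence zero.
  have hstep : ∀ f, ∃ g, E f = φ X * E g := by
    intro f
    refine ⟨PowerSeries.mk fun p => coeff (p + 1) f, ?_⟩
    conv_lhs => rw [eq_X_mul_shift_add_const f]
    rw [map_add, hC, hmul, hX, mul_zero, add_zero, add_zero]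
  have hdvd : ∀ (m : ℕ) (f : k⟦X⟧), φ X ^ m ∣ E f := by
    intro m
    induction m with
    | zero => simp
    | succ m ih =>
      intro f
      obtain ⟨g, hg⟩ := hstep f
      rw [hg, pow_succ']
      exact mul_dvd_mul_left _ (ih g)
  have h := eq_zero_of_forall_pow_dvd hφ fun m => hdvd m f
  rwa [hE, sub_eq_zero] at h

theorem derivation_apply (d : Der k) (f : k⟦X⟧) : d f = derivative k f * d X :=
  chain_rule (AlgHom.id k _) (by simp) d.toLinearMap (fun f g => by simp) f

/-- The derivation of `k⟦t⟧` with value `f` at `t`. -/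
def derX (f : k⟦X⟧) : Der k := f • derivative k

theorem derX_apply (f g : k⟦X⟧) : derX f g = f * derivative k g := rfl

variable {H : Type u} [Group H] [Finite H] (ρ : LocalAction k H)

/-- Coefficients of the polynomial `∏_h (T - h(t))` as power series in the norm. -/
theorem exists_map_normEmb_eq [Fintype H] : ∃ P : Polynomial k⟦X⟧,
    P.map (normEmb ρ.toHom : k⟦X⟧ →+* k⟦X⟧) =
      ∏ h, (Polynomial.X - Polynomial.C (ρ.toHom h X)) := by
  rw [← Polynomial.mem_lifts, Polynomial.lifts_iff_coeff_lifts]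
  intro n
  -- The group permutes the factors, so the coefficients are invariant and therefore power series in
  -- the norm.
  have hinv : (∏ h, (Polynomial.X - Polynomial.C (ρ.toHom h X))).coeff n ∈
      invariantRing ρ.toHom := by
    intro g
    have h1 : (∏ h, (Polynomial.X - Polynomial.C (ρ.toHom h X))).map
        ((ρ.toHom g : k⟦X⟧ ≃ₐ[k] k⟦X⟧) : k⟦X⟧ →+* k⟦X⟧) =
        ∏ h, (Polynomial.X - Polynomial.C (ρ.toHom h X)) := by
      simp only [Polynomial.map_prod]
      exact Fintype.prod_equiv (Equiv.mulLeft g) _ _ fun m => by simp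
    conv_rhs => rw [← h1]
    rw [Polynomial.coeff_map]
    rfl
  obtain ⟨c, hc⟩ := ρ.self.normEmb_surjective Function.surjective_id hinv
  exact ⟨c, hc⟩

theorem injective_toHom_X : Function.Injective fun h => ρ.toHom h X :=
  fun _ _ h => ρ.injective (gam_ext h)

theorem constantCoeff_normX : constantCoeff (normX ρ.toHom) = 0 :=
  (isNilpotent_normX ρ.toHom).eq_zero

/-- The different `f'(t)`, with `f = ∏_h (T - h(t))`, is `dy/dt` up to a unit, `y = ∏_h h(t)`. -/
theorem exists_isUnit_mul_derivative_normX [Fintype H] : ∃ w : k⟦X⟧, IsUnit w ∧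
    (Polynomial.derivative (∏ h, (Polynomial.X - Polynomial.C (ρ.toHom h X)))).eval X =
      w * derivative k (normX ρ.toHom) := by
  classical
  obtain ⟨P, hP⟩ := exists_map_normEmb_eq ρ
  set σ : k⟦X⟧ →ₐ[k] k⟦X⟧ := normEmb ρ.toHom with hσ
  have hσX : σ X = normX ρ.toHom := substHom_X _ _
  have hchain : ∀ c, derivative k (σ c) = σ (derivative k c) * derivative k (normX ρ.toHom) := by
    intro c
    have := chain_rule σ (by rw [hσX]; exact isNilpotent_normX _)
      ((derivative k : k⟦X⟧ →ₗ[k] k⟦X⟧) ∘ₗ σ.toLinearMap)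
      (fun f g => by simp) c
    simpa [hσX] using this
  -- The total derivative of a polynomial expression in t with coefficients in k⟦y⟧: the formal
  -- derivative, plus the contribution of the coefficients, from which dy/dt factors out. Applied to
  -- `P`, which vanishes at t, it expresses f'(t) through dy/dt.
  have heval : ∀ Q : Polynomial k⟦X⟧, derivative k ((Q.map (σ : k⟦X⟧ →+* k⟦X⟧)).eval X) =
      (Polynomial.derivative (Q.map (σ : k⟦X⟧ →+* k⟦X⟧))).eval X +
      Q.sum (fun i c => σ (derivative k c) * X ^ i) * derivative k (normX ρ.toHom) := by
    intro Q
    induction Q using Polynomial.induction_on' with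
    | add p q hp hq =>
      rw [Polynomial.map_add, Polynomial.eval_add, map_add, hp, hq, Polynomial.derivative_add,
        Polynomial.eval_add, Polynomial.sum_add_index]
      · ring
      · simp
      · intro i a b
        rw [map_add, map_add, add_mul]
    | monomial n a =>
      rw [Polynomial.map_monomial, Polynomial.eval_monomial, Polynomial.derivative_monomial,
        Polynomial.eval_monomial, Polynomial.sum_monomial_index _ _ (by simp), Derivation.leibniz,
        RingHom.coe_coe, hchain, Derivation.leibniz_pow]
      simp
      ring
  have h0 : (P.map (σ : k⟦X⟧ →+* k⟦X⟧)).eval X = 0 := by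
    rw [hP, Polynomial.eval_prod]
    exact Finset.prod_eq_zero (Finset.mem_univ 1) (by simp)
  have h1 := heval P
  rw [h0, map_zero, hP] at h1
  -- To see that this is a unit, only the term i = 0 matters, the others being divisible by t.
  refine ⟨- P.sum (fun i c => σ (derivative k c) * X ^ i), ?_, by linear_combination -h1⟩
  rw [IsUnit.neg_iff, isUnit_iff_constantCoeff]
  have hcc : ∀ c, constantCoeff (σ c) = constantCoeff c := by
    intro c
    conv_lhs => rw [eq_X_mul_shift_add_const c, map_add, map_mul, hσX,
      show σ (C (constantCoeff c)) = C (constantCoeff c) from substHom_C _ _ _]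
    simp [constantCoeff_normX]
  have hsum : constantCoeff (P.sum (fun i c => σ (derivative k c) * X ^ i)) =
      constantCoeff (derivative k (P.coeff 0)) := by
    rw [Polynomial.sum_def, map_sum]
    rw [Finset.sum_eq_single 0]
    · simp [hcc]
    · intro i _ hi
      simp [hi]
    · intro h
      rw [Polynomial.notMem_support_iff.1 h]
      simp
  rw [hsum]
  -- The constant term of ∏ (T - h(t)) is ±y, so the zeroth coefficient of `P` is ±X, with
  -- derivative ±1.
  have hc0 : σ (P.coeff 0) = σ ((-1) ^ Nat.card H * X) := by
    have h2 := congrArg (fun Q => Polynomial.coeff Q 0) hP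
    simp only [Polynomial.coeff_map, RingHom.coe_coe] at h2
    rw [h2, Polynomial.coeff_zero_eq_eval_zero, Polynomial.eval_prod]
    simp [hσX, normX, finprod_eq_prod_of_fintype, Finset.prod_neg]
  have hc1 := ρ.self.normEmb_injective Function.surjective_id hc0
  rw [hc1]
  have hneg : ((-1) ^ Nat.card H * X : k⟦X⟧) = ((-1) ^ Nat.card H : k) • X := by
    rw [smul_eq_C_mul]; simp
  rw [hneg, Derivation.map_smul]
  simp

/-- Up to a unit this is f'(t), the product of t - g(t) over g ≠ 1, and no factor vanishes because
the action is faithful. In characteristic p this expresses the separability of k⟦t⟧ over its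
invariants. -/
theorem derivative_normX_ne_zero : derivative k (normX ρ.toHom) ≠ 0 := by
  classical
  have := Fintype.ofFinite H
  obtain ⟨w, -, h⟩ := exists_isUnit_mul_derivative_normX ρ
  intro h0
  rw [h0, mul_zero] at h
  have h1 := Lagrange.eval_nodal_derivative_eval_node_eq (v := fun h => ρ.toHom h X)
    (Finset.mem_univ (1 : H))
  rw [Lagrange.nodal, Lagrange.nodal] at h1
  rw [map_one, AlgEquiv.one_apply, h, Polynomial.eval_prod, eq_comm, Finset.prod_eq_zero_iff] at h1
  obtain ⟨g, hg, h2⟩ := h1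
  rw [Polynomial.eval_sub, Polynomial.eval_X, Polynomial.eval_C, sub_eq_zero] at h2
  refine (Finset.mem_erase.1 hg).1 (injective_toHom_X ρ ?_)
  simpa using h2.symm

end Derivatives

/-! ### Der, Der^♯ and Der_1 inside k⟦t⟧. -/

section Embeddings

variable {k : Type u} [Field k] {G : Type u} [Group G] [Finite G]
  (ρ : LocalAction k G) (N : Subgroup G) [N.Normal]

/-- The isomorphism `k⟦y⟧ ≃ k⟦t⟧ ^ N`. -/
abbrev invNEquiv : k⟦X⟧ ≃ₐ[k] invN ρ N :=
  (ρ.restrict N).self.invariantEquiv Function.surjective_id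

theorem coe_invNEquiv (f : k⟦X⟧) :
    (invNEquiv ρ N f : k⟦X⟧) = normEmb (ρ.restrict N).toHom f := rfl

theorem normEmb_normEmb_mem (f : k⟦X⟧) (g : G) :
    ρ.toHom g (normEmb (ρ.restrict N).toHom (normEmb (ρ.quot N).toHom f)) =
      normEmb (ρ.restrict N).toHom (normEmb (ρ.quot N).toHom f) := by
  rw [← ρ.normEmb_quot, LocalDeformation.map_normEmb]

/-- The embedding `k⟦z⟧ → k⟦t⟧ ^ G ⊆ k⟦t⟧ ^ N`. -/
def toInvG : k⟦X⟧ →+* invG ρ N where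
  toFun f := ⟨invNEquiv ρ N (normEmb (ρ.quot N).toHom f), normEmb_normEmb_mem ρ N f⟩
  map_one' := Subtype.ext (by simp)
  map_mul' f g := Subtype.ext (by simp)
  map_zero' := Subtype.ext (by simp)
  map_add' f g := Subtype.ext (by simp)

/-- An element of k⟦y⟧ fixed by G is fixed by G/N, so it is a power series in the norm of the
quotient action. -/
theorem toInvG_bijective : Function.Bijective (toInvG ρ N) := by
  constructor
  · intro f g h
    exact (ρ.quot N).self.normEmb_injective Function.surjective_id
      ((invNEquiv ρ N).injective (congrArg Subtype.val h))
  · intro x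
    have hx : (invNEquiv ρ N).symm x ∈ invariantRing (ρ.quot N).toHom := by
      intro q
      obtain ⟨g, rfl⟩ := QuotientGroup.mk_surjective q
      apply (invNEquiv ρ N).injective
      apply Subtype.ext
      rw [coe_invNEquiv, ρ.normEmb_quot, ← coe_invNEquiv, AlgEquiv.apply_symm_apply]
      exact x.2 g
    obtain ⟨c, hc⟩ := (ρ.quot N).self.normEmb_surjective Function.surjective_id hx
    refine ⟨c, Subtype.ext ?_⟩
    rw [← (invNEquiv ρ N).apply_symm_apply (x : invN ρ N), ← hc]
    rfl

instance : IsIntegrallyClosed (invG ρ N) :=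
  IsIntegrallyClosed.of_equiv (RingEquiv.ofBijective (toInvG ρ N) (toInvG_bijective ρ N))

/-- Repeated Weierstrass division by z in k⟦y⟧ writes every series as a combination of finitely many
powers of y with coefficients in k⟦z⟧. This is the monogenicity that makes the different computable.
-/
theorem adjoin_invNEquiv_X : Algebra.adjoin (invG ρ N) {invNEquiv ρ N X} = ⊤ := by
  rw [eq_top_iff]
  rintro b -
  obtain ⟨f, rfl⟩ := (invNEquiv ρ N).surjective b
  obtain ⟨c, hc⟩ := exists_expansion (A := k) (π := RingHom.id k) Function.surjective_id
    (y := normX (ρ.quot N).toHom) (n := Nat.card (G ⧸ N))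
    (by simpa using (ρ.quot N).order_normX) (isNilpotent_normX _) f
  rw [hc, map_sum]
  refine sum_mem fun i _ => ?_
  rw [map_mul, map_pow]
  refine mul_mem (pow_mem (Algebra.self_mem_adjoin_singleton _ _) i) ?_
  exact Subalgebra.algebraMap_mem (Algebra.adjoin (invG ρ N) {invNEquiv ρ N X}) (toInvG ρ N (c i))

/-- The different of `k⟦y⟧` over `k⟦z⟧` is generated by `dz/dy`. -/
theorem differentIdeal_invN : differentIdeal (invG ρ N) (invN ρ N) =
    Ideal.span {invNEquiv ρ N (derivative k (normX (ρ.quot N).toHom))} := by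
  classical
  have := Fintype.ofFinite (G ⧸ N)
  obtain ⟨P, hP⟩ := exists_map_normEmb_eq (ρ.quot N)
  have hprod : ∏ q, (Polynomial.X - Polynomial.C (invNEquiv ρ N ((ρ.quot N).toHom q X))) =
      (∏ q, (Polynomial.X - Polynomial.C ((ρ.quot N).toHom q X))).map
        (invNEquiv ρ N : k⟦X⟧ →+* invN ρ N) := by
    simp [Polynomial.map_prod]
  have hP' : (P.map (toInvG ρ N)).map (algebraMap (invG ρ N) (invN ρ N)) =
      ∏ q, (Polynomial.X - Polynomial.C (invNEquiv ρ N ((ρ.quot N).toHom q X))) := by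
    rw [hprod, ← hP, Polynomial.map_map, Polynomial.map_map]
    rfl
  -- The conjugates of y over k⟦z⟧ are its translates under G/N; the resulting f'(y) is dz/dy up to
  -- a unit.
  rw [differentIdeal_eq_span_of_conjugates (y := invNEquiv ρ N X)
    (v := fun q => invNEquiv ρ N ((ρ.quot N).toHom q X))
    ((invNEquiv ρ N).injective.comp (injective_toHom_X (ρ.quot N))) hP' ⟨1, by simp⟩ ?_
    (adjoin_invNEquiv_X ρ N)]
  · obtain ⟨w, hw, h⟩ := exists_isUnit_mul_derivative_normX (ρ.quot N)
    have h1 : (Polynomial.derivative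
        (∏ q, (Polynomial.X - Polynomial.C (invNEquiv ρ N ((ρ.quot N).toHom q X))))).eval
          (invNEquiv ρ N X) =
        invNEquiv ρ N w * invNEquiv ρ N (derivative k (normX (ρ.quot N).toHom)) := by
      rw [hprod, Polynomial.derivative_map]
      refine (Polynomial.eval_map_apply (f := (invNEquiv ρ N : k⟦X⟧ →+* invN ρ N)) X).trans ?_
      rw [h]
      exact map_mul (invNEquiv ρ N) _ _
    rw [h1, Ideal.span_singleton_mul_left_unit (hw.map (invNEquiv ρ N))]
  · intro q
    obtain ⟨g, rfl⟩ := QuotientGroup.mk_surjective q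
    refine ⟨actN ρ N g, Subtype.ext ?_⟩
    rw [coe_actN, coe_invNEquiv, coe_invNEquiv, ρ.normEmb_quot]

theorem Der1_eq_span : Der1 ρ N =
    Ideal.span {normEmb (ρ.restrict N).toHom (derivative k (normX (ρ.quot N).toHom))} := by
  rw [Der1, differentIdeal_invN, Ideal.map_span, Set.image_singleton]
  rfl

theorem mem_Der1 {f : k⟦X⟧} : f ∈ Der1 ρ N ↔
    ∃ r, f = normEmb (ρ.restrict N).toHom (derivative k (normX (ρ.quot N).toHom)) * r := by
  rw [Der1_eq_span, Ideal.mem_span_singleton]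
  rfl

/-- A derivation along `k⟦y⟧ → k⟦t⟧` has its value at `y_G` in `Der_1`. -/
theorem apply_normX_mem_Der1 (D : k⟦X⟧ →ₗ[k] k⟦X⟧)
    (hD : ∀ f g, D (f * g) = normEmb (ρ.restrict N).toHom f * D g +
      normEmb (ρ.restrict N).toHom g * D f) :
    D (normX (ρ.quot N).toHom) ∈ Der1 ρ N := by
  rw [mem_Der1, chain_rule (normEmb (ρ.restrict N).toHom) ?_ D hD]
  · exact ⟨_, rfl⟩
  · rw [normEmb, substHom_X]
    exact isNilpotent_normX _

theorem theta_apply (d : Der k) : theta ρ d = d (normX ρ.toHom) := rfl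

theorem thetaSharp_apply (d : Der k) : thetaSharp ρ N d =
    normEmb (ρ.restrict N).toHom (d (normX (ρ.quot N).toHom)) := rfl

theorem theta_mem_Der1 (d : Der k) : theta ρ d ∈ Der1 ρ N := by
  rw [theta_apply, ← normEmb_normX_quot ρ N]
  exact apply_normX_mem_Der1 ρ N (d.toLinearMap ∘ₗ (normEmb (ρ.restrict N).toHom).toLinearMap)
    fun f g => by simp

/-- A derivation takes at z the value dz/dt times its value at t, and dz/dt is nonzero. -/
theorem theta_injective : Function.Injective (theta ρ) := by
  rw [injective_iff_map_eq_zero]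
  intro d hd
  rw [theta_apply, derivation_apply, mul_eq_zero, or_iff_right (derivative_normX_ne_zero ρ)] at hd
  apply Derivation.ext
  intro f
  rw [derivation_apply, hd, mul_zero, Derivation.zero_apply]

theorem thetaSharp_injective : Function.Injective (thetaSharp ρ N) := by
  rw [injective_iff_map_eq_zero]
  intro d hd
  apply theta_injective (ρ.quot N)
  rw [map_zero]
  exact (injective_iff_map_eq_zero _).1
    ((ρ.restrict N).self.normEmb_injective Function.surjective_id) _ hd

theorem thetaSharp_mem_invN (d : Der k) : thetaSharp ρ N d ∈ invN ρ N :=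
  fun n => LocalDeformation.map_normEmb (ρ.restrict N).toHom n _

theorem toHom_thetaSharp (n : N) (d : Der k) :
    ρ.toHom n (thetaSharp ρ N d) = thetaSharp ρ N d := thetaSharp_mem_invN ρ N d n

theorem thetaSharp_mem_Der1 (d : Der k) : thetaSharp ρ N d ∈ Der1 ρ N :=
  apply_normX_mem_Der1 ρ N ((normEmb (ρ.restrict N).toHom).toLinearMap ∘ₗ d.toLinearMap)
    fun f g => by simp

/-- The generator dz/dy of Der_1 is nonzero and itself N-invariant. Hence (dz/dy) r is invariant
only if r ∈ k⟦y⟧, and then it is the value at z of the derivation r d/dy. -/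
theorem mem_Der1N_iff {f : k⟦X⟧} : f ∈ Der1N ρ N ↔ ∃ d, thetaSharp ρ N d = f := by
  constructor
  · rintro ⟨h1, h2⟩
    obtain ⟨r, rfl⟩ := (mem_Der1 ρ N).1 h1
    have hr : r ∈ invN ρ N := by
      intro n
      have h := h2 n
      rw [map_mul, LocalDeformation.map_normEmb] at h
      refine mul_left_cancel₀ ?_ h
      exact (map_ne_zero_iff _ ((ρ.restrict N).self.normEmb_injective
        Function.surjective_id)).2 (derivative_normX_ne_zero (ρ.quot N))
    obtain ⟨c, rfl⟩ := (ρ.restrict N).self.normEmb_surjective Function.surjective_id hr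
    refine ⟨derX c, ?_⟩
    rw [thetaSharp_apply, derX_apply, map_mul, mul_comm]
    rfl
  · rintro ⟨d, rfl⟩
    exact ⟨thetaSharp_mem_Der1 ρ N d, thetaSharp_mem_invN ρ N d⟩

theorem exists_thetaSharp_eq {f : k⟦X⟧} (h1 : f ∈ Der1 ρ N) (h2 : ∀ n : N, ρ.toHom n f = f) :
    ∃ d, thetaSharp ρ N d = f :=
  (mem_Der1N_iff ρ N).1 ⟨h1, h2⟩

theorem thetaSharp_conj (g : G) (d : Der k) :
    thetaSharp ρ N (derAction (ρ.quot N) g d) = ρ.toHom g (thetaSharp ρ N d) := by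
  have h : derAction (ρ.quot N) g d (normX (ρ.quot N).toHom) =
      (ρ.quot N).toHom g (d (normX (ρ.quot N).toHom)) := theta_conj (ρ.quot N) g d
  rw [thetaSharp_apply, h, ρ.normEmb_quot]
  rfl

/-- Inside k⟦t⟧ the submodule Der^N is simply Der ∩ Der^♯; this is what reduces congruences modulo
Der^N to congruences modulo Der. -/
theorem mem_DerNSharp_iff {D : Der k} :
    D ∈ DerNSharp ρ N ↔ ∃ d, theta ρ d = thetaSharp ρ N D := by
  constructor
  · rintro ⟨d, -, h⟩
    exact ⟨d, by rw [thetaSharp_apply, h, normEmb_normX_quot]; rfl⟩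
  · rintro ⟨d, hd⟩
    -- The value of `d` at z is N-invariant, and `theta` is injective and equivariant.
    have hinv : ∀ n ∈ N, derAction ρ n d = d := fun n hn => theta_injective ρ <| by
      rw [theta_conj, hd]
      exact toHom_thetaSharp ρ N ⟨n, hn⟩ D
    have hdN : ∀ u, ∃ c, normEmb (ρ.restrict N).toHom c = d (normEmb (ρ.restrict N).toHom u) := by
      intro u
      refine (ρ.restrict N).self.normEmb_surjective Function.surjective_id fun n => ?_
      have h1 := DFunLike.congr_fun (hinv n n.2) (normEmb (ρ.restrict N).toHom u)
      have h2 : (ρ.toHom n)⁻¹ (normEmb (ρ.restrict N).toHom u) =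
          normEmb (ρ.restrict N).toHom u := by
        rw [← map_inv]
        exact LocalDeformation.map_normEmb (ρ.restrict N).toHom n⁻¹ u
      rw [derAction_apply, conjDer_apply, h2] at h1
      exact h1
    have hinj := (ρ.restrict N).self.normEmb_injective Function.surjective_id
    choose c hc using hdN
    -- Being N-invariant, `d` preserves k⟦y⟧; `E` is its restriction, determined by its value at y.
    -- It coincides with `D` because the two agree at z.
    let E : Der k := derX (c X)
    have hE : ∀ u, normEmb (ρ.restrict N).toHom (E u) = d (normEmb (ρ.restrict N).toHom u) := by
      intro u
      have hX : IsNilpotent (constantCoeff (normEmb (ρ.restrict N).toHom X)) := by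
        rw [normEmb, substHom_X]; exact isNilpotent_normX _
      have h := chain_rule (normEmb (ρ.restrict N).toHom) hX
        (d.toLinearMap ∘ₗ (normEmb (ρ.restrict N).toHom).toLinearMap) (fun f g => by simp) u
      refine Eq.trans ?_ h.symm
      rw [derX_apply, map_mul, hc, mul_comm]
      rfl
    have hED : E = D := thetaSharp_injective ρ N <| by
      rw [thetaSharp_apply, hE, normEmb_normX_quot, ← hd]
      rfl
    exact ⟨d, hinv, fun u => by rw [← hED, hE]⟩

end Embeddings

/-! ### The first-order deformation of the invariants and the cocycle of the induced lift. -/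

section InducedCocycle

open groupCohomology CategoryTheory

variable {k : Type u} [Field k]

theorem inc_C (c : k) : inc k (C c) = C (TrivSqZeroExt.inl c) := by
  simp [inc]

/-- Minus the `ε`-part of the embedding `k[ε]⟦y⟧ → k[ε]⟦t⟧` attached to a lift: a derivation along
the embedding `k⟦y⟧ → k⟦t⟧`. -/
def Lift.alongDer {H : Type u} [Group H] [Finite H] {ρ : LocalAction k H}
    (L : Lift ρ (dualRes k)) : k⟦X⟧ →ₗ[k] k⟦X⟧ where
  toFun f := - sndS (normEmb L.toHom (inc k f))
  map_add' f g := by rw [map_add, map_add, sndS_add, neg_add]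
  map_smul' c f := by
    have h : normEmb L.toHom (inc k (C c)) = inc k (C c) := by
      rw [inc_C]
      exact substHom_C _ _ _
    rw [smul_eq_C_mul, map_mul, map_mul, h, sndS_mul, sndS_inc, mul_zero, add_zero, fstS_inc,
      RingHom.id_apply, smul_eq_C_mul, mul_neg]

variable {H : Type u} [Group H] [Finite H] {ρ : LocalAction k H}

theorem Lift.alongDer_apply (L : Lift ρ (dualRes k)) (f : k⟦X⟧) :
    L.alongDer f = - sndS (normEmb L.toHom (inc k f)) := rfl

theorem Lift.fstS_normEmb_inc (L : Lift ρ (dualRes k)) (f : k⟦X⟧) :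
    fstS (normEmb L.toHom (inc k f)) = normEmb ρ.toHom f := by
  rw [L.map_normEmb, fstS_inc]

theorem Lift.alongDer_mul (L : Lift ρ (dualRes k)) (f g : k⟦X⟧) :
    L.alongDer (f * g) = normEmb ρ.toHom f * L.alongDer g + normEmb ρ.toHom g * L.alongDer f := by
  simp only [Lift.alongDer_apply, map_mul, sndS_mul, L.fstS_normEmb_inc]
  ring

theorem Lift.sndS_toHom (L : Lift ρ (dualRes k)) (g : H) (f : (DualNumber k)⟦X⟧) :
    sndS (L.toHom g f) = ρ.toHom g (sndS f) + L.cocycle g (ρ.toHom g (fstS f)) := by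
  rw [L.toHom_eq, extAut_apply, sndS_extFun]

/-- On the invariants the cocycle of a lift is the coboundary of `alongDer`. -/
theorem Lift.cocycle_apply_normEmb (L : Lift ρ (dualRes k)) (s : H) (f : k⟦X⟧) :
    L.cocycle s (normEmb ρ.toHom f) = ρ.toHom s (L.alongDer f) - L.alongDer f := by
  have h := congrArg sndS (LocalDeformation.map_normEmb L.toHom s (inc k f))
  rw [L.sndS_toHom, L.fstS_normEmb_inc, LocalDeformation.map_normEmb] at h
  rw [Lift.alongDer_apply, map_neg]
  linear_combination h

theorem Lift.sndS_normEmb_eps_inc (L : Lift ρ (dualRes k)) (f : k⟦X⟧) :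
    sndS (normEmb L.toHom (epsS k * inc k f)) = normEmb ρ.toHom f := by
  have h : normEmb L.toHom (epsS k) = epsS k := substHom_C _ _ _
  rw [map_mul, h, sndS_mul, fstS_eps, zero_mul, zero_add, L.fstS_normEmb_inc]
  have : sndS (epsS k) = 1 := by
    have := sndS_eps_inc (k := k) 1
    rwa [map_one, mul_one] at this
  rw [this, mul_one]

variable (N : Subgroup H)

theorem Lift.sndS_normEmb_restrict (L : Lift ρ (dualRes k)) (f : (DualNumber k)⟦X⟧) :
    sndS (normEmb (L.restrict N).toHom f) =
      normEmb (ρ.restrict N).toHom (sndS f) - (L.restrict N).alongDer (fstS f) := by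
  conv_lhs => rw [eq_inc_add f]
  rw [map_add, sndS_add, Lift.sndS_normEmb_eps_inc, Lift.alongDer_apply]
  ring

variable [N.Normal]

/-- The cocycle of the induced lift. -/
theorem Lift.thetaSharp_cocycle_ind (L : Lift ρ (dualRes k)) (g : H) :
    thetaSharp ρ N ((L.ind (dualRes_surjective k) N).cocycle g) =
      theta ρ (L.cocycle g) -
        (ρ.toHom g ((L.restrict N).alongDer (normX (ρ.quot N).toHom)) -
          (L.restrict N).alongDer (normX (ρ.quot N).toHom)) := by
  set z := normX (ρ.quot N).toHom with hz
  -- The deformed embedding intertwines the induced action with the lifted one. Since z is fixed by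
  -- the residual actions, the ε-parts of this identity at z involve only the two cocycles and the
  -- ε-part of the embedding.
  have h := congrArg sndS (L.normEmb_indHom (dualRes_surjective k) N g (inc k z))
  have h1 : sndS (L.indHom (dualRes_surjective k) N g (inc k z)) =
      (L.ind (dualRes_surjective k) N).cocycle g z := by
    refine ((L.ind (dualRes_surjective k) N).sndS_toHom g _).trans ?_
    rw [sndS_inc, fstS_inc, map_zero, zero_add, hz, LocalDeformation.map_normX]
  have h2 : fstS (L.indHom (dualRes_surjective k) N g (inc k z)) = z := by
    refine ((L.ind (dualRes_surjective k) N).reduces g _).trans ?_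
    rw [fstS_inc, hz, LocalDeformation.map_normX]
  rw [L.sndS_normEmb_restrict N, h1, h2, L.sndS_toHom, (L.restrict N).fstS_normEmb_inc, hz,
    normEmb_normX_quot ρ N, LocalDeformation.map_normX, ← hz] at h
  have h3 : sndS (normEmb (L.restrict N).toHom (inc k z)) = - (L.restrict N).alongDer z := by
    rw [Lift.alongDer_apply, neg_neg]
  rw [h3, map_neg] at h
  rw [thetaSharp_apply, theta_apply, ← hz]
  linear_combination h

theorem Lift.alongDer_normX_mem_Der1 (L : Lift (ρ.restrict N) (dualRes k)) :
    L.alongDer (normX (ρ.quot N).toHom) ∈ Der1 ρ N :=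
  apply_normX_mem_Der1 ρ N _ L.alongDer_mul

variable (ρ)

/-- Every class in `H¹(N, Der)` dies in `H¹(N, Der_1)`. -/
theorem exists_mem_Der1_coboundary (d : cocycles₁ (DerRep (ρ.restrict N))) :
    ∃ α ∈ Der1 ρ N, ∀ s : N, theta ρ (d s) = ρ.toHom s α - α := by
  -- The element α comes from the lift of the N-action defined by `d`: it measures how that lift
  -- moves the invariant z.
  refine ⟨_, (Lift.ofCocycle d).alongDer_normX_mem_Der1 N, fun s => ?_⟩
  have h := (Lift.ofCocycle d).cocycle_apply_normEmb s (normX (ρ.quot N).toHom)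
  rw [Lift.cocycle_ofCocycle, normEmb_normX_quot] at h
  exact h

end InducedCocycle

/-! ### Linear maps from relations, and classes in H¹. -/

section General

open groupCohomology CategoryTheory

/-- A total additive homogeneous relation relating `0` only to `0` is the graph of a linear map. -/
theorem exists_linearMap_of_rel {k V W : Type*} [Ring k] [AddCommGroup V] [Module k V]
    [AddCommGroup W] [Module k W] (R : V → W → Prop) (htot : ∀ x, ∃ y, R x y)
    (hadd : ∀ x y x' y', R x y → R x' y' → R (x + x') (y + y'))
    (hsmul : ∀ (c : k) x y, R x y → R (c • x) (c • y)) (hzero : ∀ y, R 0 y → y = 0) :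
    ∃ f : V →ₗ[k] W, ∀ x y, f x = y ↔ R x y := by
  -- Subtracting two values at the same point gives a value at 0.
  have huniq : ∀ x y y', R x y → R x y' → y = y' := by
    intro x y y' h h'
    have h1 := hadd _ _ _ _ h (hsmul (-1) _ _ h')
    rw [neg_one_smul, neg_one_smul, add_neg_cancel] at h1
    exact add_neg_eq_zero.1 (hzero _ h1)
  choose f hf using htot
  refine ⟨⟨⟨f, fun x x' => ?_⟩, fun c x => ?_⟩, fun x y => ⟨?_, fun h => huniq _ _ _ (hf x) h⟩⟩
  · exact huniq _ _ _ (hf _) (hadd _ _ _ _ (hf x) (hf x'))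
  · exact huniq _ _ _ (hf _) (hsmul _ _ _ (hf x))
  · rintro rfl
    exact hf x

theorem H1π_eq_H1π_iff {k G : Type u} [CommRing k] [Group G] {A : Rep.{u} k G}
    (x y : cocycles₁ A) :
    H1π A x = H1π A y ↔ ∃ m : A, ∀ g, x g - y g = A.ρ g m - m := by
  rw [H1π_eq_iff]
  constructor
  · rintro ⟨m, hm⟩
    exact ⟨m, fun g => (congrFun hm g).symm⟩
  · rintro ⟨m, hm⟩
    exact ⟨m, funext fun g => (hm g).symm⟩

theorem H1π_surjective {k G : Type u} [CommRing k] [Group G] {A : Rep.{u} k G} (x : H1 A) :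
    ∃ c, H1π A c = x := by
  induction x using H1_induction_on with | h c => exact ⟨c, rfl⟩

end General

/-! ### Cocycles and coboundaries as functions with values in k⟦t⟧. -/

section Cocycles

open groupCohomology CategoryTheory

variable {k : Type u} [Field k] {G : Type u} [Group G] [Finite G]
  (ρ : LocalAction k G) (N : Subgroup G) [N.Normal]

/-- Injectivity and equivariance of `theta` transfer the condition to k⟦t⟧. The analogous criteria
for N and G/N put all three groups in one ambient module, with functions on G/N read on G. -/
theorem mem_cocycles₁_DerRep {c : G → Der k} : c ∈ cocycles₁ (DerRep ρ) ↔
    ∀ g h, theta ρ (c (g * h)) = ρ.toHom g (theta ρ (c h)) + theta ρ (c g) := by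
  rw [mem_cocycles₁_iff]
  refine forall₂_congr fun g h => ?_
  rw [← theta_conj, ← map_add, (theta_injective ρ).eq_iff]

theorem theta_cocycle_mul (c : cocycles₁ (DerRep ρ)) (g h : G) :
    theta ρ (c (g * h)) = ρ.toHom g (theta ρ (c h)) + theta ρ (c g) :=
  (mem_cocycles₁_DerRep ρ).1 c.2 g h

theorem H1π_DerRep_eq_iff (c c' : cocycles₁ (DerRep ρ)) :
    H1π (DerRep ρ) c = H1π (DerRep ρ) c' ↔
      ∃ m, ∀ g, theta ρ (c g) - theta ρ (c' g) = ρ.toHom g (theta ρ m) - theta ρ m := by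
  rw [H1π_eq_H1π_iff]
  refine exists_congr fun m => forall_congr' fun g => ?_
  rw [← theta_conj, ← map_sub, ← map_sub, (theta_injective ρ).eq_iff]

theorem H1π_DerRep_restrict_eq_iff (d d' : cocycles₁ (DerRep (ρ.restrict N))) :
    H1π (DerRep (ρ.restrict N)) d = H1π (DerRep (ρ.restrict N)) d' ↔
      ∃ m, ∀ s : N, theta ρ (d s) - theta ρ (d' s) = ρ.toHom s (theta ρ m) - theta ρ m := by
  rw [H1π_eq_H1π_iff]
  refine exists_congr fun m => forall_congr' fun g => ?_
  rw [← theta_conj, ← map_sub, ← map_sub, (theta_injective ρ).eq_iff]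
  rfl

theorem mem_cocycles₁_DerRep_quot {e : G ⧸ N → Der k} : e ∈ cocycles₁ (DerRep (ρ.quot N)) ↔
    ∀ g h : G, thetaSharp ρ N (e (g * h : G)) =
      ρ.toHom g (thetaSharp ρ N (e h)) + thetaSharp ρ N (e g) := by
  rw [mem_cocycles₁_iff, QuotientGroup.mk_surjective.forall₂]
  refine forall₂_congr fun g h => ?_
  rw [← thetaSharp_conj, ← map_add, (thetaSharp_injective ρ N).eq_iff]
  rfl

theorem thetaSharp_cocycle_mul (e : cocycles₁ (DerRep (ρ.quot N))) (g h : G) :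
    thetaSharp ρ N (e (g * h : G)) = ρ.toHom g (thetaSharp ρ N (e h)) + thetaSharp ρ N (e g) :=
  (mem_cocycles₁_DerRep_quot ρ N).1 e.2 g h

theorem H1π_DerRep_quot_eq_iff (e e' : cocycles₁ (DerRep (ρ.quot N))) :
    H1π (DerRep (ρ.quot N)) e = H1π (DerRep (ρ.quot N)) e' ↔
      ∃ u, ∀ g : G, thetaSharp ρ N (e g) - thetaSharp ρ N (e' g) =
        ρ.toHom g (thetaSharp ρ N u) - thetaSharp ρ N u := by
  rw [H1π_eq_H1π_iff]
  refine exists_congr fun m => ?_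
  rw [QuotientGroup.mk_surjective.forall]
  refine forall_congr' fun g => ?_
  rw [← thetaSharp_conj, ← map_sub, ← map_sub, (thetaSharp_injective ρ N).eq_iff]

theorem DerSharpQuot_ρ_mkQ (g : G) (u : Der k) :
    (DerSharpQuot ρ N).ρ g ((DerNSharp ρ N).mkQ u) =
      (DerNSharp ρ N).mkQ (derAction (ρ.quot N) g u) := rfl

/-- Equality in `Der^♯/Der^N`. -/
theorem mkQ_DerNSharp_eq_iff {u v : Der k} :
    (DerNSharp ρ N).mkQ u = (DerNSharp ρ N).mkQ v ↔
      ∃ m, theta ρ m = thetaSharp ρ N u - thetaSharp ρ N v := by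
  rw [Submodule.mkQ_apply, Submodule.mkQ_apply, Submodule.Quotient.eq, mem_DerNSharp_iff, map_sub]

/-- Elements of `Der^♯` representing a function on `G/N` with values in `Der^♯/Der^N` form a
cocycle if they do so modulo `Der`. -/
theorem mem_cocycles₁_DerSharpQuot {z : G ⧸ N → Der k ⧸ DerNSharp ρ N} {a : G → Der k}
    (hz : ∀ g : G, z g = (DerNSharp ρ N).mkQ (a g)) :
    z ∈ cocycles₁ (DerSharpQuot ρ N) ↔ ∀ g h : G, ∃ m, theta ρ m = thetaSharp ρ N (a (g * h)) -
      (ρ.toHom g (thetaSharp ρ N (a h)) + thetaSharp ρ N (a g)) := by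
  rw [mem_cocycles₁_iff, QuotientGroup.mk_surjective.forall₂]
  refine forall₂_congr fun g h => ?_
  have h1 : z ((g : G ⧸ N) * (h : G ⧸ N)) = (DerNSharp ρ N).mkQ (a (g * h)) := hz (g * h)
  rw [h1, hz, hz, DerSharpQuot_ρ_mkQ, ← thetaSharp_conj, ← map_add (thetaSharp ρ N),
    ← mkQ_DerNSharp_eq_iff, map_add]

/-- Representatives in Der^♯ need only agree up to the coboundary of an element of Der^♯ and an
error in Der. -/
theorem H1π_DerSharpQuot_eq_iff {z z' : cocycles₁ (DerSharpQuot ρ N)} {a a' : G → Der k}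
    (hz : ∀ g : G, z g = (DerNSharp ρ N).mkQ (a g))
    (hz' : ∀ g : G, z' g = (DerNSharp ρ N).mkQ (a' g)) :
    H1π (DerSharpQuot ρ N) z = H1π (DerSharpQuot ρ N) z' ↔
      ∃ u, ∀ g : G, ∃ m, theta ρ m = thetaSharp ρ N (a g) - thetaSharp ρ N (a' g) -
        (ρ.toHom g (thetaSharp ρ N u) - thetaSharp ρ N u) := by
  rw [H1π_eq_H1π_iff]
  refine ((DerNSharp ρ N).mkQ_surjective.exists (p := fun m : Der k ⧸ DerNSharp ρ N =>
    ∀ g, z g - z' g = (DerSharpQuot ρ N).ρ g m - m)).trans ?_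
  refine exists_congr fun u => ?_
  rw [QuotientGroup.mk_surjective.forall]
  refine forall_congr' fun g => ?_
  rw [hz, hz', DerSharpQuot_ρ_mkQ, ← thetaSharp_conj, ← map_sub (thetaSharp ρ N),
    ← map_sub (thetaSharp ρ N), ← mkQ_DerNSharp_eq_iff, map_sub, map_sub]

theorem sigma_H1π (e : cocycles₁ (DerRep (ρ.quot N))) :
    ∃ z : cocycles₁ (DerSharpQuot ρ N), (∀ q, z q = (DerNSharp ρ N).mkQ (e q)) ∧
      sigma ρ N (H1π _ e) = H1π _ z :=
  ⟨_, fun _ => rfl, H1π_comp_map_apply _ _ e⟩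

theorem conjH1_H1π (g : G) (d : cocycles₁ (DerRep (ρ.restrict N))) :
    ∃ d' : cocycles₁ (DerRep (ρ.restrict N)),
      (∀ n, theta ρ (d' n) = ρ.toHom g (theta ρ (d (MulAut.conjNormal g⁻¹ n)))) ∧
      conjH1 ρ N g (H1π _ d) = H1π _ d' :=
  ⟨_, fun n => (theta_conj ρ g (d (MulAut.conjNormal g⁻¹ n))), H1π_comp_map_apply _ _ d⟩

theorem mem_H1Inv {κ : H1 (DerRep (ρ.restrict N))} :
    κ ∈ H1Inv ρ N ↔ ∀ g, conjH1 ρ N g κ = κ := by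
  simp [H1Inv, Submodule.mem_iInf, LinearMap.mem_eqLocus]

/-- The restriction `H¹(G, Der) → H¹(N, Der)`. -/
def resH1 : H1 (DerRep ρ) →ₗ[k] H1 (DerRep (ρ.restrict N)) :=
  (groupCohomology.map (A := DerRep ρ) (B := DerRep (ρ.restrict N)) N.subtype
    (Rep.ofHom ⟨LinearMap.id, fun _ => rfl⟩) 1).hom

theorem resH1_H1π (c : cocycles₁ (DerRep ρ)) :
    ∃ d : cocycles₁ (DerRep (ρ.restrict N)), (∀ n : N, d n = c n) ∧
      resH1 ρ N (H1π _ c) = H1π _ d :=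
  ⟨_, fun _ => rfl, H1π_comp_map_apply _ _ c⟩

/-- Conjugation by g changes the restricted cocycle by the coboundary of c_g: expand c at s g = g
(g⁻¹ s g) in two ways. -/
theorem resH1_mem_H1Inv (x : H1 (DerRep ρ)) : resH1 ρ N x ∈ H1Inv ρ N := by
  obtain ⟨c, rfl⟩ := H1π_surjective x
  obtain ⟨d, hd, h⟩ := resH1_H1π ρ N c
  rw [h, mem_H1Inv]
  intro g
  obtain ⟨d', hd', h'⟩ := conjH1_H1π ρ N g d
  rw [h', H1π_DerRep_restrict_eq_iff]
  refine ⟨c g, fun s => ?_⟩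
  have h1 := theta_cocycle_mul ρ c g (g⁻¹ * s * g)
  have h2 : g * (g⁻¹ * s * g) = s * g := by group
  rw [h2, theta_cocycle_mul] at h1
  have h3 : theta ρ (d (MulAut.conjNormal g⁻¹ s)) = theta ρ (c (g⁻¹ * s * g)) := by
    rw [hd]
    simp
  rw [hd', h3, hd]
  linear_combination -h1

end Cocycles

/-! ### Induction on tangent spaces, the map γ, the kernel and the image. -/

section TangentMap

open groupCohomology CategoryTheory

variable {k : Type u} [Field k] {G : Type u} [Group G] [Finite G]
  (ρ : LocalAction k G) (N : Subgroup G) [N.Normal]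

/-- The map on cohomology classes given by the induction of deformations, as a relation. -/
def IndRel (x : H1 (DerRep ρ)) (y : H1 (DerRep (ρ.quot N))) : Prop :=
  ∃ (c : cocycles₁ (DerRep ρ)) (e : cocycles₁ (DerRep (ρ.quot N))) (α : k⟦X⟧),
    H1π _ c = x ∧ H1π _ e = y ∧ α ∈ Der1 ρ N ∧
    ∀ g : G, thetaSharp ρ N (e g) = theta ρ (c g) - (ρ.toHom g α - α)

theorem indRel_tangentEquiv (x : Deform ρ (dualRes k)) :
    IndRel ρ N (tangentEquiv ρ x)
      (tangentEquiv (ρ.quot N) (Deform.resInd (dualRes_surjective k) N x).2) := by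
  induction x using Quotient.inductionOn with | h L =>
  exact ⟨L.cocycle, (L.ind (dualRes_surjective k) N).cocycle, _, rfl, rfl,
    (L.restrict N).alongDer_normX_mem_Der1 N, L.thetaSharp_cocycle_ind N⟩

theorem resH1_tangentEquiv (x : Deform ρ (dualRes k)) :
    resH1 ρ N (tangentEquiv ρ x) =
      tangentEquiv (ρ.restrict N) (Deform.resInd (dualRes_surjective k) N x).1.1 := by
  induction x using Quotient.inductionOn with | h L =>
  obtain ⟨d, hd, h⟩ := resH1_H1π ρ N L.cocycle
  refine h.trans ?_
  change H1π _ d = H1π _ (L.restrict N).cocycle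
  congr 1
  exact cocycles₁_ext hd

/-- An element of `Der_1` whose translates by `N` agree with it comes from `Der^♯`. -/
theorem exists_thetaSharp_eq_sub {α : k⟦X⟧} (hα : α ∈ Der1 ρ N) (m : Der k)
    (h : ∀ s : N, ρ.toHom s α - α = ρ.toHom s (theta ρ m) - theta ρ m) :
    ∃ u, thetaSharp ρ N u = α - theta ρ m := by
  refine exists_thetaSharp_eq ρ N (sub_mem hα (theta_mem_Der1 ρ N m)) fun s => ?_
  rw [map_sub]
  linear_combination h s

/-- If c = ∂m, then α - m is N-invariant and so lies in Der^♯; therefore e = ∂(m - α) is already a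
coboundary in Der^♯. This makes the class of e independent of the choices of c and α. -/
theorem IndRel.eq_zero {y : H1 (DerRep (ρ.quot N))} (h : IndRel ρ N 0 y) : y = 0 := by
  obtain ⟨c, e, α, hc, rfl, hα, he⟩ := h
  rw [← map_zero (H1π (DerRep ρ)).hom] at hc
  obtain ⟨m, hm⟩ := (H1π_DerRep_eq_iff ρ c 0).1 hc
  have hm' : ∀ g, theta ρ (c g) = ρ.toHom g (theta ρ m) - theta ρ m := fun g => by
    rw [← hm g]
    exact (by rw [show (0 : cocycles₁ (DerRep ρ)) g = 0 from rfl, map_zero, sub_zero])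
  -- A cocycle of G/N vanishes at the identity coset, so on N the relation reads ∂α = ∂m.
  obtain ⟨u, hu⟩ := exists_thetaSharp_eq_sub ρ N hα m fun s => by
    have h1 := he s
    rw [(QuotientGroup.eq_one_iff (s : G)).2 s.2, cocycles₁_map_one, map_zero, hm'] at h1
    linear_combination h1
  rw [← map_zero (H1π (DerRep (ρ.quot N))).hom]
  refine (H1π_DerRep_quot_eq_iff ρ N e 0).2 ⟨-u, fun g => ?_⟩
  rw [show (0 : cocycles₁ (DerRep (ρ.quot N))) (g : G ⧸ N) = 0 from rfl, he, hm', map_neg, hu]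
  simp only [map_neg, map_sub, map_zero]
  ring

/-- Totality comes from deformations, as every class is the tangent class of a lift. Linearity is
visible only on the relation, where the triples (c, e, α) form a vector space. -/
theorem exists_indMap : ∃ f : H1 (DerRep ρ) →ₗ[k] H1 (DerRep (ρ.quot N)),
    ∀ x y, f x = y ↔ IndRel ρ N x y := by
  apply exists_linearMap_of_rel
  · intro x
    obtain ⟨x, rfl⟩ := (tangentEquiv ρ).surjective x
    exact ⟨_, indRel_tangentEquiv ρ N x⟩
  · rintro _ _ _ _ ⟨c, e, α, rfl, rfl, hα, he⟩ ⟨c', e', α', rfl, rfl, hα', he'⟩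
    refine ⟨c + c', e + e', α + α', map_add _ _ _, map_add _ _ _, add_mem hα hα', fun g => ?_⟩
    change thetaSharp ρ N (e g + e' g) = theta ρ (c g + c' g) - _
    simp only [map_add, he, he']
    ring
  · rintro r _ _ ⟨c, e, α, rfl, rfl, hα, he⟩
    refine ⟨r • c, r • e, r • α, map_smul _ _ _, map_smul _ _ _,
      Submodule.smul_of_tower_mem _ r hα, fun g => ?_⟩
    change thetaSharp ρ N (r • e g) = theta ρ (r • c g) - _
    simp only [map_smul, he, smul_sub]
  · exact fun y h => h.eq_zero

/-- Invariance of κ says that α^g - α has the same coboundary on N as some m ∈ Der; the difference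
is then an element a_g of Der_1^N = Der^♯. -/
theorem GammaGraph.exists (κ : H1Inv ρ N) : ∃ c, GammaGraph ρ N κ c := by
  obtain ⟨d, hd⟩ := H1π_surjective (κ : H1 (DerRep (ρ.restrict N)))
  obtain ⟨α, hα, hαd⟩ := exists_mem_Der1_coboundary ρ N d
  have key : ∀ g, ∃ a b, ρ.toHom g α - α = thetaSharp ρ N a + theta ρ b := by
    intro g
    obtain ⟨d', hd', h'⟩ := conjH1_H1π ρ N g d
    have h1 := (mem_H1Inv ρ N).1 κ.2 g
    rw [← hd, h'] at h1
    -- The conjugated cocycle is the coboundary of α^g on N, so `m` compares it with that of α.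
    obtain ⟨m, hm⟩ := (H1π_DerRep_restrict_eq_iff ρ N d' d).1 h1
    obtain ⟨u, hu⟩ := exists_thetaSharp_eq_sub ρ N (sub_mem (Der1_stable ρ N g α hα) hα) m
      fun s => by
        have h2 := hm s
        have h3 : ρ.toHom g (ρ.toHom (g⁻¹ * s * g) α) = ρ.toHom s (ρ.toHom g α) := by
          rw [← AlgEquiv.mul_apply, ← AlgEquiv.mul_apply, ← map_mul, ← map_mul]
          congr 2
          group
        rw [hd', hαd, hαd, MulAut.conjNormal_apply, inv_inv, map_sub, h3] at h2
        rw [map_sub]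
        linear_combination h2
    exact ⟨u, m, by rw [hu]; ring⟩
  choose a b hab using key
  -- Replacing g by g s changes α^g by (d_s)^g, which lies in Der.
  have hN : ∀ (g : G) (s : N), (DerNSharp ρ N).mkQ (a (g * s)) = (DerNSharp ρ N).mkQ (a g) := by
    intro g s
    rw [mkQ_DerNSharp_eq_iff]
    refine ⟨derAction ρ g (d s) + b g - b (g * s), ?_⟩
    have h1 := hab (g * s)
    rw [map_mul, AlgEquiv.mul_apply] at h1
    have h2 := congrArg (ρ.toHom g) (hαd s)
    rw [map_sub] at h2
    rw [map_sub, map_add, theta_conj]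
    linear_combination h2 + h1 - hab g
  let z : G ⧸ N → Der k ⧸ DerNSharp ρ N := fun q => (DerNSharp ρ N).mkQ (a q.out)
  have hz : ∀ g : G, z g = (DerNSharp ρ N).mkQ (a g) := by
    intro g
    obtain ⟨s, hs⟩ := QuotientGroup.mk_out_eq_mul N g
    change (DerNSharp ρ N).mkQ (a (g : G ⧸ N).out) = _
    rw [hs, hN]
  -- Since a + b = ∂α is a cocycle, the failure of a to be one is the opposite of that of b, hence
  -- lies in Der.
  have hzc : z ∈ cocycles₁ (DerSharpQuot ρ N) := by
    rw [mem_cocycles₁_DerSharpQuot ρ N hz]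
    intro g h
    refine ⟨derAction ρ g (b h) + b g - b (g * h), ?_⟩
    have h1 := hab (g * h)
    rw [map_mul, AlgEquiv.mul_apply] at h1
    have h2 := congrArg (ρ.toHom g) (hab h)
    rw [map_sub, map_add] at h2
    rw [map_sub, map_add, theta_conj]
    linear_combination h1 - h2 - hab g
  exact ⟨_, d, α, a, b, ⟨z, hzc⟩, hd, hα, hαd, hab, hz, rfl⟩

/-- If d = ∂m on N, then u = α - m lies in Der^♯ and a is ∂u modulo Der. -/
theorem GammaGraph.eq_zero {c : H1 (DerSharpQuot ρ N)} (h : GammaGraph ρ N 0 c) : c = 0 := by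
  obtain ⟨d, α, a, b, z, hd, hα, hαd, hab, hz, rfl⟩ := h
  rw [neg_eq_zero, ← map_zero (H1π (DerSharpQuot ρ N)).hom]
  rw [ZeroMemClass.coe_zero, ← map_zero (H1π (DerRep (ρ.restrict N))).hom] at hd
  obtain ⟨m, hm⟩ := (H1π_DerRep_restrict_eq_iff ρ N d 0).1 hd
  obtain ⟨u, hu⟩ := exists_thetaSharp_eq_sub ρ N hα m fun s => by
    rw [← hm s, ← hαd, show (0 : cocycles₁ (DerRep (ρ.restrict N))) s = 0 from rfl, map_zero,
      sub_zero]
  refine (H1π_DerSharpQuot_eq_iff ρ N (z' := 0) (a' := 0) hz fun g => ?_).2 ⟨u, fun g => ?_⟩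
  · exact (map_zero (DerNSharp ρ N).mkQ).symm
  · refine ⟨derAction ρ g m - m - b g, ?_⟩
    have h1 := hab g
    rw [map_sub, map_sub, theta_conj, hu, Pi.zero_apply, map_zero, map_sub]
    linear_combination h1

theorem exists_gamma : ∃ γ : H1Inv ρ N →ₗ[k] H1 (DerSharpQuot ρ N),
    ∀ κ c, γ κ = c ↔ GammaGraph ρ N κ c := by
  apply exists_linearMap_of_rel
  · exact GammaGraph.exists ρ N
  · rintro κ _ κ' _ ⟨d, α, a, b, z, hd, hα, hαd, hab, hz, rfl⟩
      ⟨d', α', a', b', z', hd', hα', hαd', hab', hz', rfl⟩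
    refine ⟨d + d', α + α', a + a', b + b', z + z', ?_, add_mem hα hα', fun s => ?_, fun g => ?_,
      fun g => ?_, ?_⟩
    · rw [map_add, hd, hd']; rfl
    · change theta ρ (d s + d' s) = _
      simp only [map_add, hαd, hαd']
      ring
    · simp only [Pi.add_apply, map_add]
      linear_combination hab g + hab' g
    · change z g + z' g = _
      rw [hz, hz', Pi.add_apply, map_add]
    · rw [map_add, neg_add]
  · rintro r κ _ ⟨d, α, a, b, z, hd, hα, hαd, hab, hz, rfl⟩
    refine ⟨r • d, r • α, r • a, r • b, r • z, ?_, Submodule.smul_of_tower_mem _ r hα,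
      fun s => ?_, fun g => ?_, fun g => ?_, ?_⟩
    · rw [map_smul, hd]; rfl
    · change theta ρ (r • d s) = _
      simp only [map_smul, hαd, smul_sub]
    · simp only [Pi.smul_apply, map_smul]
      rw [← smul_sub, hab, smul_add]
    · change r • z g = _
      rw [hz, Pi.smul_apply, map_smul]
    · rw [map_smul, smul_neg]
  · exact fun c h => h.eq_zero

/-- The class of the cocycle `g ↦ b^g - b` attached to an invariant of `Der_1^N/Der^N`. -/
def CobRel (x : (quotAction ρ N).invariants) (y : H1 (DerRep ρ)) : Prop :=
  ∃ (b : Der1N ρ N) (c : cocycles₁ (DerRep ρ)), (DerN ρ N).mkQ b = x ∧ H1π _ c = y ∧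
    ∀ g, theta ρ (c g) = ρ.toHom g b - b

theorem mem_DerN {b : Der1N ρ N} : b ∈ DerN ρ N ↔ ∃ m, theta ρ m = b := Iff.rfl

theorem CobRel.exists (x : (quotAction ρ N).invariants) : ∃ y, CobRel ρ N x y := by
  obtain ⟨x, hx⟩ := x
  obtain ⟨b, rfl⟩ := (DerN ρ N).mkQ_surjective x
  have key : ∀ g, ∃ m, theta ρ m = ρ.toHom g b - b := by
    intro g
    have h1 : (DerN ρ N).mkQ (der1NAction ρ N g b) = (DerN ρ N).mkQ b := hx g
    rw [Submodule.mkQ_apply, Submodule.mkQ_apply, Submodule.Quotient.eq, mem_DerN] at h1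
    exact h1
  choose c hc using key
  have hcc : c ∈ cocycles₁ (DerRep ρ) := by
    rw [mem_cocycles₁_DerRep]
    intro g h
    rw [hc, hc, hc, map_mul, AlgEquiv.mul_apply, map_sub]
    ring
  exact ⟨_, b, ⟨c, hcc⟩, rfl, rfl, hc⟩

/-- The cocycle ∂b equals ∂m with m ∈ Der exactly when b - m is G-invariant, that is, when b is
congruent modulo Der^N to an element of Der_1^G. -/
theorem CobRel.eq_zero_iff {x : (quotAction ρ N).invariants} {y : H1 (DerRep ρ)}
    (h : CobRel ρ N x y) : y = 0 ↔ x ∈ LinearMap.range (invariantsMap ρ N) := by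
  obtain ⟨b, c, hx, rfl, hc⟩ := h
  rw [← map_zero (H1π (DerRep ρ)).hom]
  refine (H1π_DerRep_eq_iff ρ c 0).trans ?_
  simp only [hc, show ∀ g, (0 : cocycles₁ (DerRep ρ)) g = 0 from fun _ => rfl, map_zero, sub_zero]
  constructor
  · rintro ⟨m, hm⟩
    have hmem : (b : k⟦X⟧) - theta ρ m ∈ Der1N ρ N :=
      ⟨sub_mem b.2.1 (theta_mem_Der1 ρ N m), fun s => by
        change ρ.toHom s _ = _
        rw [map_sub]
        linear_combination hm s⟩
    refine ⟨⟨⟨_, hmem⟩, fun g => Subtype.ext ?_⟩, Subtype.ext ?_⟩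
    · change ρ.toHom g ((b : k⟦X⟧) - theta ρ m) = b - theta ρ m
      rw [map_sub]
      linear_combination hm g
    · rw [← hx]
      refine (Submodule.Quotient.eq _).2 ?_
      refine ⟨-m, ?_⟩
      rw [map_neg]
      change _ = (b : k⟦X⟧) - theta ρ m - b
      ring
  · rintro ⟨⟨b', hb'⟩, rfl⟩
    obtain ⟨m, hm⟩ := (Submodule.Quotient.eq (DerN ρ N)).1 hx
    replace hm : theta ρ m = (b : k⟦X⟧) - b' := hm
    refine ⟨m, fun g => ?_⟩
    have h1 : ρ.toHom g b' = b' := congrArg Subtype.val (hb' g)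
    rw [hm, map_sub, h1]
    ring

theorem exists_cobMap : ∃ f : (quotAction ρ N).invariants →ₗ[k] H1 (DerRep ρ),
    ∀ x y, f x = y ↔ CobRel ρ N x y := by
  apply exists_linearMap_of_rel
  · exact CobRel.exists ρ N
  · rintro x _ x' _ ⟨b, c, hx, rfl, hc⟩ ⟨b', c', hx', rfl, hc'⟩
    refine ⟨b + b', c + c', ?_, map_add _ _ _, fun g => ?_⟩
    · rw [map_add, hx, hx']; rfl
    · change theta ρ (c g + c' g) = ρ.toHom g ((b : k⟦X⟧) + b') - (b + b')
      simp only [map_add, hc, hc']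
      ring
  · rintro r x _ ⟨b, c, hx, rfl, hc⟩
    refine ⟨r • b, r • c, ?_, map_smul _ _ _, fun g => ?_⟩
    · rw [map_smul, hx]; rfl
    · change theta ρ (r • c g) = ρ.toHom g (r • (b : k⟦X⟧)) - r • (b : k⟦X⟧)
      simp only [map_smul, hc, smul_sub]
  · exact fun y h => h.eq_zero_iff.2 (zero_mem _)

/-- The common kernel of restriction and induction. -/
theorem exists_cobRel_iff (y : H1 (DerRep ρ)) :
    (∃ x, CobRel ρ N x y) ↔ resH1 ρ N y = 0 ∧ IndRel ρ N y 0 := by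
  constructor
  · rintro ⟨x, b, c, -, rfl, hc⟩
    constructor
    · obtain ⟨d, hd, h⟩ := resH1_H1π ρ N c
      rw [h, ← map_zero (H1π (DerRep (ρ.restrict N))).hom]
      congr 1
      refine cocycles₁_ext fun s => theta_injective ρ ?_
      rw [hd, hc, show (0 : cocycles₁ (DerRep (ρ.restrict N))) s = 0 from rfl, map_zero, sub_eq_zero]
      exact b.2.2 s
    -- The element b itself serves as α, giving e = ∂b - ∂b = 0.
    · refine ⟨c, 0, b, rfl, map_zero _, b.2.1, fun g => ?_⟩
      rw [hc, sub_self]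
      exact map_zero _
  · rintro ⟨h1, c, e, α, rfl, he0, hα, he⟩
    obtain ⟨d, hd, h⟩ := resH1_H1π ρ N c
    rw [h, ← map_zero (H1π (DerRep (ρ.restrict N))).hom] at h1
    obtain ⟨m, hm⟩ := (H1π_DerRep_restrict_eq_iff ρ N d 0).1 h1
    rw [← map_zero (H1π (DerRep (ρ.quot N))).hom] at he0
    obtain ⟨u, hu⟩ := (H1π_DerRep_quot_eq_iff ρ N e 0).1 he0
    simp only [hd, show ∀ g, (0 : cocycles₁ (DerRep (ρ.restrict N))) g = 0 from fun _ => rfl,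
      show ∀ g, (0 : cocycles₁ (DerRep (ρ.quot N))) g = 0 from fun _ => rfl, map_zero,
      sub_zero] at hm hu
    obtain ⟨v, hv⟩ := exists_thetaSharp_eq_sub ρ N hα m fun s => by
      have h2 := he s
      rw [(QuotientGroup.eq_one_iff (s : G)).2 s.2, cocycles₁_map_one, map_zero, hm] at h2
      linear_combination h2
    -- From c - ∂α = ∂u and v = α - m one gets c - ∂m = ∂(u + v), so b = u + v.
    let b : Der1N ρ N := ⟨thetaSharp ρ N (u + v), (mem_Der1N_iff ρ N).2 ⟨_, rfl⟩⟩
    have hb : (b : k⟦X⟧) = thetaSharp ρ N u + (α - theta ρ m) := by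
      rw [← hv, ← map_add]
    let e0 : cocycles₁ (DerRep ρ) := ⟨fun g => c g - (derAction ρ g m - m), by
      rw [mem_cocycles₁_DerRep]
      intro g h
      simp only [map_sub, theta_conj, theta_cocycle_mul, map_mul ρ.toHom, AlgEquiv.mul_apply]
      ring⟩
    have he0 : ∀ g, theta ρ (e0 g) = ρ.toHom g b - b := by
      intro g
      change theta ρ (c g - (derAction ρ g m - m)) = _
      rw [hb, map_sub, map_sub, theta_conj, map_add, map_sub]
      have h2 := hu g
      rw [he] at h2
      linear_combination h2
    have hinv : (DerN ρ N).mkQ b ∈ (quotAction ρ N).invariants := by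
      intro g
      refine (Submodule.Quotient.eq _).2 ?_
      exact ⟨e0 g, he0 g⟩
    refine ⟨⟨_, hinv⟩, b, e0, rfl, ?_, he0⟩
    refine (H1π_DerRep_eq_iff ρ e0 c).2 ⟨-m, fun g => ?_⟩
    change theta ρ (c g - (derAction ρ g m - m)) - _ = _
    simp only [map_sub, map_neg, theta_conj]
    ring

/-- The identity ∂α = -e + c is a decomposition of the kind that defines γ, with a = -e and b = c;
the sign in γ turns -[a] into σ[e]. -/
theorem IndRel.gamma_eq_sigma {x : H1 (DerRep ρ)} {y : H1 (DerRep (ρ.quot N))}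
    (h : IndRel ρ N x y) : GammaGraph ρ N ⟨resH1 ρ N x, resH1_mem_H1Inv ρ N x⟩ (sigma ρ N y) := by
  obtain ⟨c, e, α, rfl, rfl, hα, he⟩ := h
  obtain ⟨d, hd, h⟩ := resH1_H1π ρ N c
  obtain ⟨z, hz, hσ⟩ := sigma_H1π ρ N e
  refine ⟨d, α, fun g => -e g, c, -z, h.symm, hα, fun s => ?_, fun g => ?_, fun g => ?_, ?_⟩
  · have h2 := he s
    rw [(QuotientGroup.eq_one_iff (s : G)).2 s.2, cocycles₁_map_one, map_zero] at h2
    rw [hd]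
    linear_combination -h2
  · rw [map_neg, he]
    ring
  · rw [map_neg, ← hz]
    rfl
  · rw [hσ, map_neg, neg_neg]

/-- Equality of the two classes gives u ∈ Der^♯ with e + a - ∂u valued in Der. Adding b yields e +
∂(α - u), a cocycle valued in Der whose restriction to N is d and which induces e. -/
theorem exists_indRel_of_gammaGraph {κ : H1Inv ρ N} {y : H1 (DerRep (ρ.quot N))}
    (h : GammaGraph ρ N κ (sigma ρ N y)) : ∃ x, resH1 ρ N x = κ ∧ IndRel ρ N x y := by
  obtain ⟨d, α, a, b, z, hd, hα, hαd, hab, hz, hγ⟩ := h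
  obtain ⟨e, rfl⟩ := H1π_surjective y
  obtain ⟨z', hz', hσ⟩ := sigma_H1π ρ N e
  rw [hσ, ← map_neg] at hγ
  obtain ⟨u, hu⟩ := (H1π_DerSharpQuot_eq_iff ρ N (a := fun g => e g) (a' := fun g => - a g)
    (fun g => hz' g) (fun g => by rw [map_neg, ← hz]; rfl)).1 hγ
  choose m hm using hu
  have hc : ∀ g, theta ρ (m g + b g) = thetaSharp ρ N (e g) +
      (ρ.toHom g (α - thetaSharp ρ N u) - (α - thetaSharp ρ N u)) := by
    intro g
    rw [map_add, hm, map_neg, map_sub]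
    linear_combination -(hab g)
  -- Inside k⟦t⟧ this is the inflation of e plus a coboundary, hence a cocycle.
  let c : cocycles₁ (DerRep ρ) := ⟨fun g => m g + b g, by
    rw [mem_cocycles₁_DerRep]
    intro g h
    rw [hc, hc, hc, thetaSharp_cocycle_mul, map_mul, AlgEquiv.mul_apply]
    simp only [map_add, map_sub]
    ring⟩
  refine ⟨H1π _ c, ?_, c, e, α - thetaSharp ρ N u, rfl, rfl,
    sub_mem hα (thetaSharp_mem_Der1 ρ N u), fun g => ?_⟩
  · obtain ⟨d', hd', h⟩ := resH1_H1π ρ N c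
    rw [h, ← hd]
    congr 1
    refine cocycles₁_ext fun s => theta_injective ρ ?_
    rw [hd', hαd]
    refine (hc s).trans ?_
    rw [(QuotientGroup.eq_one_iff (s : G)).2 s.2, cocycles₁_map_one, map_zero, map_sub,
      toHom_thetaSharp]
    ring
  · refine (eq_sub_iff_add_eq.2 (hc g).symm)

end TangentMap

end LocalDeformation

end

/-! ### Assembly of the theorem. -/

open LocalDeformation groupCohomology
theorem mainTheorem5 {k : Type u} [Field k] (p : ℕ) [Fact p.Prime] [CharP k p] [PerfectField k]
    {G : Type u} [Group G] [Finite G] (ρ : LocalAction k G) (N : Subgroup G) [N.Normal] :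
    ∃ (dΦ : H1 (DerRep ρ) →ₗ[k] H1Inv ρ N × H1 (DerRep (ρ.quot N)))
      (γ : H1Inv ρ N →ₗ[k] H1 (DerSharpQuot ρ N)),
      -- `dΦ` is the map `Φ` over the dual numbers
      (∀ x : Deform ρ (dualRes k),
        ((dΦ (tangentEquiv ρ x)).1 : H1 (DerRep (ρ.restrict N))) =
            tangentEquiv (ρ.restrict N) (Deform.resInd (dualRes_surjective k) N x).1.1 ∧
          (dΦ (tangentEquiv ρ x)).2 =
            tangentEquiv (ρ.quot N) (Deform.resInd (dualRes_surjective k) N x).2) ∧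
      -- the description of `γ`
      (∀ (κ : H1Inv ρ N) (c : H1 (DerSharpQuot ρ N)), γ κ = c ↔ GammaGraph ρ N κ c) ∧
      -- the kernel
      (∃ e : CokerInv ρ N ≃ₗ[k] LinearMap.ker dΦ,
        ∀ (b : Der1N ρ N) (hb : (DerN ρ N).mkQ b ∈ (quotAction ρ N).invariants)
          (c : cocycles₁ (DerRep ρ)),
          (∀ g : G, theta ρ (c g) = ρ.toHom g b - b) →
            (e ((LinearMap.range (invariantsMap ρ N)).mkQ ⟨(DerN ρ N).mkQ b, hb⟩) :
              H1 (DerRep ρ)) = H1π (DerRep ρ) c) ∧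
      -- the image
      LinearMap.range dΦ =
        LinearMap.eqLocus (γ ∘ₗ LinearMap.fst k (H1Inv ρ N) (H1 (DerRep (ρ.quot N))))
          (sigma ρ N ∘ₗ LinearMap.snd k (H1Inv ρ N) (H1 (DerRep (ρ.quot N)))) := by
  obtain ⟨ind, hind⟩ := exists_indMap ρ N
  obtain ⟨γ, hγ⟩ := exists_gamma ρ N
  obtain ⟨cob, hcob⟩ := exists_cobMap ρ N
  let dΦ : H1 (DerRep ρ) →ₗ[k] H1Inv ρ N × H1 (DerRep (ρ.quot N)) :=
    ((resH1 ρ N).codRestrict (H1Inv ρ N) (resH1_mem_H1Inv ρ N)).prod ind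
  have hdΦ : ∀ x, dΦ x = (⟨resH1 ρ N x, resH1_mem_H1Inv ρ N x⟩, ind x) := fun x => rfl
  -- With kernel and range of `cob` identified, the first isomorphism theorem gives the description
  -- of the kernel of `dΦ`.
  have hker : LinearMap.ker cob = LinearMap.range (invariantsMap ρ N) := by
    ext x
    exact ((hcob x _).1 rfl).eq_zero_iff
  have hrange : LinearMap.range cob = LinearMap.ker dΦ := by
    ext y
    rw [LinearMap.mem_ker, hdΦ, Prod.mk_eq_zero, hind, Submodule.mk_eq_zero,
      ← exists_cobRel_iff ρ N, LinearMap.mem_range]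
    exact exists_congr fun x => hcob x y
  refine ⟨dΦ, γ, fun x => ⟨resH1_tangentEquiv ρ N x, (hind _ _).2 (indRel_tangentEquiv ρ N x)⟩, hγ,
    ⟨(Submodule.quotEquivOfEq _ _ hker.symm).trans
      (cob.quotKerEquivRange.trans (LinearEquiv.ofEq _ _ hrange)), fun b hb c hc =>
      (hcob _ _).2 ⟨b, c, rfl, rfl, hc⟩⟩, ?_⟩
  ext ⟨κ, y⟩
  rw [LinearMap.mem_range, LinearMap.mem_eqLocus]
  simp only [LinearMap.comp_apply, LinearMap.fst_apply, LinearMap.snd_apply, hγ]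
  constructor
  · rintro ⟨x, hx⟩
    rw [hdΦ, Prod.mk.injEq, hind] at hx
    obtain ⟨rfl, h⟩ := hx
    exact h.gamma_eq_sigma
  · intro h
    obtain ⟨x, hx, h'⟩ := exists_indRel_of_gammaGraph ρ N h
    exact ⟨x, Prod.ext (Subtype.ext hx) ((hind _ _).2 h')⟩
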